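/- Let $d\ge 1$, $0\le i<d/2$, let $\mathcal A$ be the space of affine $i$-dimensional subspaces ($i$-flats) of $\mathbb R^d$ with its usual Borel $\sigma$-algebra, let $\theta$ be a $\sigma$-finite non-atomic measure on $\mathcal A$, let $t>0$, and let $\eta_t$ be a Poisson process on $\mathcal A$ with intensity measure $t\theta$. Let $W\subset\mathbb R^d$ be compact and convex, and put $[W]=\{h\in\mathcal A: h\cap W\ne\emptyset\}$. For $h_1,h_2\in\mathcal A$ let $d(h_1,h_2)=\min\{\|z-y\|: y\in h_1,\ z\in h_2\}$, and let $m(h_1,h_2)=\tfrac12(x_1+x_2)$, where $x_1\in h_1$, $x_2\in h_2$ are points with $\|x_2-x_1\|=d(h_1,h_2)$; these are unique if $h_1,h_2$ are in general position, and otherwise "$m(h_1,h_2)\in W$" means that $\tfrac12(x_1+x_2)\in W$ for some such $x_1,x_2$. Let $\delta\in\mathbb R$. The process is observed on $[W]$; let $$\Pi_t=\frac12\,\#\{(h_1,h_2): h_1,h_2\in\eta_t\cap[W],\ h_1\neq h_2,\ d(h_1,h_2)\le\delta,\ m(h_1,h_2)\in W\},$$ and for $h\in[W]$ let $B(h,\delta)=\{g\in[W]: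 d(g,h)\le\delta\}$. **Theorem.** Let $m\in\mathbb R$ be a median of $\Pi_t$. Then for every $u>0$ with $$\frac{u}{\sqrt{u+m}}\ \ge\ e^{2}\,t\,\sup_{h\in[W]}\theta(B(h,\delta))$$ one has $$\mathbb P(|\Pi_t-m|\ge u)\ \le\ 4\,t\,\theta([W])\,\exp\Big(-\frac1{16}\,\frac{u}{\sqrt{u+m}}\Big).$$ -/

import Mathlib

open MeasureTheory ProbabilityTheory
open scoped ENNReal NNReal

/-- An `i`-flat of `ℝ^d`: a nonempty affine subspace of dimension `i`. -/
structure Flat (d i : ℕ) where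
  /-- the underlying affine subspace -/
  toAffineSubspace : AffineSubspace ℝ (EuclideanSpace ℝ (Fin d))
  nonempty' : (toAffineSubspace : Set (EuclideanSpace ℝ (Fin d))).Nonempty
  finrank_direction : Module.finrank ℝ toAffineSubspace.direction = i

namespace Flat

variable {d i : ℕ}

/-- The set of points of a flat. -/
def points (h : Flat d i) : Set (EuclideanSpace ℝ (Fin d)) := h.toAffineSubspace

/-- The orthogonal projection of `ℝ^d` onto the direction space of a flat. -/
noncomputable def directionProj (h : Flat d i) :
    EuclideanSpace ℝ (Fin d) →L[ℝ] EuclideanSpace ℝ (Fin d) :=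
  h.toAffineSubspace.direction.starProjection

/-- The point of a flat that is closest to the origin. -/
noncomputable def foot (h : Flat d i) : EuclideanSpace ℝ (Fin d) :=
  haveI : Nonempty h.toAffineSubspace := h.nonempty'.to_subtype
  (EuclideanGeometry.orthogonalProjection h.toAffineSubspace 0 : EuclideanSpace ℝ (Fin d))

/-- The usual topology of the affine Grassmannian: a flat is determined by its direction
(encoded by the orthogonal projection onto it) and by its foot point, and flats converge when
both of them do. -/
noncomputable instance : TopologicalSpace (Flat d i) :=
  TopologicalSpace.induced (fun h => (h.directionProj, h.foot)) inferInstance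

/-- The Borel `σ`-algebra of the affine Grassmannian. -/
noncomputable instance : MeasurableSpace (Flat d i) := borel (Flat d i)

instance : BorelSpace (Flat d i) := ⟨rfl⟩

/-- `[W]`: the set of flats that meet `W`. -/
def hitting (W : Set (EuclideanSpace ℝ (Fin d))) : Set (Flat d i) :=
  {h | (h.points ∩ W).Nonempty}

/-- The distance `d(h₁, h₂) = min ‖z - y‖` over `y ∈ h₁`, `z ∈ h₂`
(the infimum over a pair of flats is attained). -/
noncomputable def flatDist (h₁ h₂ : Flat d i) : ℝ :=
  ⨅ p : h₁.points × h₂.points, dist (p.1 : EuclideanSpace ℝ (Fin d)) p.2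

/-- `p` is the midpoint of a shortest segment `[x₁, x₂]` between `h₁` and `h₂`. For two flats
in general position (direction spaces with trivial intersection) there is exactly one such
segment, so exactly one such `p`. -/
def IsMidpoint (h₁ h₂ : Flat d i) (p : EuclideanSpace ℝ (Fin d)) : Prop :=
  ∃ x₁ ∈ h₁.points, ∃ x₂ ∈ h₂.points, dist x₁ x₂ = flatDist h₁ h₂ ∧ p = midpoint ℝ x₁ x₂

/-- The flats of `[W]` at distance at most `δ` from `h`: the `δ`-ball around `h` in the state
space `[W]`. -/
def ball (W : Set (EuclideanSpace ℝ (Fin d))) (h : Flat d i) (δ : ℝ) : Set (Flat d i) :=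
  {g | g ∈ hitting W ∧ flatDist h g ≤ δ}

/-- Half the number of ordered pairs of distinct flats of the configuration `η`, observed in the
window `W` (i.e. restricted to `[W]`), that are at distance at most `δ` and have
their midpoint in `W`. -/
noncomputable def midpointCount (W : Set (EuclideanSpace ℝ (Fin d))) (δ : ℝ)
    (η : Set (Flat d i)) : ℝ≥0∞ :=
  (1 / 2 : ℝ≥0∞) *
    (({q : Flat d i × Flat d i | q.1 ∈ η ∩ hitting W ∧ q.2 ∈ η ∩ hitting W ∧ q.1 ≠ q.2 ∧
        flatDist q.1 q.2 ≤ δ ∧ ∃ p ∈ W, IsMidpoint q.1 q.2 p}.encard : ℕ∞) : ℝ≥0∞)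

end Flat

/-- `η` is a (simple) Poisson point process on `X` with intensity measure `μ`, as a random set of
points: the number of points in a measurable set `A` is Poisson distributed with parameter `μ A`
(almost surely infinite if `μ A = ∞`), and the numbers of points in pairwise
disjoint measurable sets are independent. -/
structure IsPoissonProcess {Ω X : Type*} [MeasurableSpace Ω] [MeasurableSpace X]
    (η : Ω → Set X) (μ : Measure X) (P : Measure Ω) : Prop where
  measurable_count : ∀ A : Set X, MeasurableSet A → Measurable fun ω => (η ω ∩ A).encard
  map_count : ∀ A : Set X, MeasurableSet A → μ A ≠ ∞ →
    P.map (fun ω => (η ω ∩ A).encard) =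
      (poissonMeasure (μ A).toNNReal).map (fun n : ℕ => (n : ℕ∞))
  count_eq_top : ∀ A : Set X, MeasurableSet A → μ A = ∞ → ∀ᵐ ω ∂P, (η ω ∩ A).encard = ⊤
  indep_count : ∀ (n : ℕ) (A : Fin n → Set X), (∀ j, MeasurableSet (A j)) →
    Pairwise (Function.onFun Disjoint A) → iIndepFun (fun j ω => (η ω ∩ A j).encard) P

/-- The real number `m` is a median of the extended nonnegative random variable `Y`. -/
def IsMedian {Ω : Type*} [MeasurableSpace Ω] (P : Measure Ω) (Y : Ω → ℝ≥0∞) (m : ℝ) : Prop :=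
  1 / 2 ≤ P {ω | (Y ω : EReal) ≤ (m : EReal)} ∧ 1 / 2 ≤ P {ω | (m : EReal) ≤ (Y ω : EReal)}

/-! Half the count of ordered close pairs is the number of edges of a random graph whose vertices
are the points of a Poisson process on `[W]`. Deleting a set of points destroys at most as many
edges as the sum of their degrees. This suggests Talagrand's convex distance with the degrees as
weights: if all degrees are at most `D` and there are `x` edges, the sum of the squared degrees is
at most `2 D x`. Hence a configuration with at least `b` edges and degrees at most `D` has squared
distance at least `(b - a)² / (2 D b)` from the configurations with at most `a` edges, and the
product of the two probabilities is at most `exp (-(b - a)² / (12 D b))`.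

With `r = u / √(u + m)` and `D = 2 r / 3`, the choices `(a, b) = (m, m + u)` and `(m - u, m)` both
give at most `exp (-r / 8)`, and the median property bounds one factor from below. A degree above
`D` is rare: the neighbours of a given point are Poisson with mean at most `r / e²`, so a union
bound over the points costs `t θ([W])` times a Poisson tail.

The convex distance inequality is proved for Bernoulli subsets of a finite set
(`exists_convexDistance`, `bernoulliProb_pairCount_mul_le`). It passes to the Poisson process
through a fine partition into cells. Because the intensity has no atoms, with probability close to
one no two points share a cell and the relation between points is a relation between their cells
(`exists_discrepancy_lt`). The occupied cells then form a Bernoulli subset carrying an isomorphic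
graph (`measureReal_pairCount_mul_le`). The same discretisation yields the degree bound
`measure_exists_le_degreeIn_le`, and `measureReal_median_le` combines the two. -/

/-- The optimisation over the interpolation parameter in Talagrand's induction. -/
theorem exists_interpolation_exp_le {r : ℝ} (hr0 : 0 < r) (hr1 : r ≤ 1) :
    ∃ l : ℝ, 0 ≤ l ∧ l ≤ 1 ∧ Real.exp ((1 - l) ^ 2 / 6 - l * Real.log r) ≤ 2 - r := by
  set y := -Real.log r with hy
  have hy0 : 0 ≤ y := by rw [hy]; linarith [Real.log_nonpos hr0.le hr1]
  have hr : r = Real.exp (-y) := by rw [hy, neg_neg, Real.exp_log hr0]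
  have hlog : Real.log r = -y := by rw [hy]; ring
  have hexp : ∀ x : ℝ, 0 ≤ x → x ≤ 1 → Real.exp x ≤ 1 + x + x ^ 2 := by
    intro x h0 h1
    have := Real.abs_exp_sub_one_sub_id_le (x := x) (by rw [abs_of_nonneg h0]; exact h1)
    have := (abs_le.1 this).2
    linarith
  have hneg : Real.exp (-y) ≤ 1 - y + y ^ 2 / 2 := by
    have h := Real.quadratic_le_exp_of_nonneg hy0
    have h2 : 0 < 1 + y + y ^ 2 / 2 := by positivity
    rw [Real.exp_neg]
    refine (inv_anti₀ h2 h).trans ?_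
    rw [inv_le_iff_one_le_mul₀ h2]
    nlinarith [sq_nonneg (y ^ 2)]
  by_cases hy3 : y ≤ 1 / 3
  -- The exponent `(1 - l)² / 6 + l y` is minimal at `l = 1 - 3 y`, which is admissible exactly for
  -- `y ≤ 1 / 3`. The second-order terms of the Taylor bounds then cancel: `-3/2 + 1 + 1/2 = 0`. For
  -- larger `y`, `l = 0` suffices.
  · refine ⟨1 - 3 * y, by linarith, by linarith, ?_⟩
    have e : (1 - (1 - 3 * y)) ^ 2 / 6 - (1 - 3 * y) * Real.log r = y - 3 / 2 * y ^ 2 := by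
      rw [hlog]; ring
    rw [e]
    have hz0 : 0 ≤ y - 3 / 2 * y ^ 2 := by nlinarith
    have h1 := hexp _ hz0 (by nlinarith)
    have h2 : (y - 3 / 2 * y ^ 2) ^ 2 ≤ y ^ 2 := by
      apply pow_le_pow_left₀ hz0; nlinarith
    linarith
  · push Not at hy3
    refine ⟨0, le_rfl, zero_le_one, ?_⟩
    have h1 := hexp (1 / 6) (by norm_num) (by norm_num)
    have h2 : Real.exp (-y) ≤ Real.exp (-(1 / 3)) := Real.exp_le_exp.2 (by linarith)
    have h3 : Real.exp (-(1 / 3 : ℝ)) ≤ 4 / 5 := by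
      rw [Real.exp_neg, inv_le_comm₀ (Real.exp_pos _) (by norm_num)]
      have := Real.add_one_le_exp (1 / 3 : ℝ)
      linarith
    rw [hr]
    norm_num at h1 ⊢
    linarith

/-! ### Talagrand's convex distance inequality for Bernoulli subsets -/

section BernoulliCube

variable {J : Type*} [DecidableEq J]

/-- The probability that a random subset of `s`, which contains every `j ∈ s` independently with
probability `p j`, equals `S`. -/
noncomputable def bernoulliWeight (p : J → ℝ) (s S : Finset J) : ℝ :=
  (∏ j ∈ S, p j) * ∏ j ∈ s \ S, (1 - p j)

variable {p : J → ℝ}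

theorem bernoulliWeight_nonneg (hp0 : ∀ j, 0 ≤ p j) (hp1 : ∀ j, p j < 1) (s S : Finset J) :
    0 ≤ bernoulliWeight p s S :=
  mul_nonneg (Finset.prod_nonneg fun j _ => hp0 j)
    (Finset.prod_nonneg fun j _ => by linarith [hp1 j])

theorem bernoulliWeight_insert_of_notMem {s S : Finset J} {a : J} (ha : a ∉ s) (hS : S ⊆ s) :
    bernoulliWeight p (insert a s) S = (1 - p a) * bernoulliWeight p s S := by
  have haS : a ∉ S := fun h => ha (hS h)
  unfold bernoulliWeight
  rw [Finset.insert_sdiff_of_notMem _ haS, Finset.prod_insert (by simp [ha])]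
  ring

theorem bernoulliWeight_insert_insert {s S : Finset J} {a : J} (ha : a ∉ s) (hS : S ⊆ s) :
    bernoulliWeight p (insert a s) (insert a S) = p a * bernoulliWeight p s S := by
  have haS : a ∉ S := fun h => ha (hS h)
  unfold bernoulliWeight
  rw [Finset.insert_sdiff_insert, Finset.prod_insert haS,
    Finset.sdiff_insert_of_notMem ha]
  ring

/-- Conditioning on whether `a` is chosen; this drives the induction on the ground set. -/
theorem sum_bernoulliWeight_insert {s : Finset J} {a : J} (ha : a ∉ s) (f : Finset J → ℝ) :
    ∑ S ∈ (insert a s).powerset, bernoulliWeight p (insert a s) S * f S =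
      (1 - p a) * ∑ S ∈ s.powerset, bernoulliWeight p s S * f S +
        p a * ∑ S ∈ s.powerset, bernoulliWeight p s S * f (insert a S) := by
  rw [Finset.sum_powerset_insert ha, Finset.mul_sum, Finset.mul_sum]
  congr 1 <;> refine Finset.sum_congr rfl fun S hS => ?_
  · rw [bernoulliWeight_insert_of_notMem ha (Finset.mem_powerset.1 hS), mul_assoc]
  · rw [bernoulliWeight_insert_insert ha (Finset.mem_powerset.1 hS), mul_assoc]

open Classical in
/-- The probability of a family of sets under the Bernoulli weights. -/
noncomputable def bernoulliProb (p : J → ℝ) (s : Finset J) (A : Set (Finset J)) : ℝ :=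
  ∑ S ∈ s.powerset, bernoulliWeight p s S * if S ∈ A then 1 else 0

/-- Interpolating two dominating costs. -/
theorem interpolation_sq_le {l f₀ f₁ X b x₀ x₁ : ℝ} (hl0 : 0 ≤ l) (hl1 : l ≤ 1) (hf₀ : 0 ≤ f₀)
    (hf₁ : 0 ≤ f₁) (hX : 0 ≤ X) (hb : 0 ≤ b) (h0 : 0 ≤ x₀) (h1 : 0 ≤ x₁)
    (hx₀ : x₀ ^ 2 ≤ f₀ * X) (hx₁ : x₁ ^ 2 ≤ f₁ * X) :
    (l * x₁ + (1 - l) * (x₀ + b)) ^ 2 ≤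
      (l * f₁ + (1 - l) * f₀ + (1 - l) ^ 2) * (b ^ 2 + X) := by
  set y := l * x₁ + (1 - l) * x₀ with hy
  set g := l * f₁ + (1 - l) * f₀ with hg
  have hg0 : 0 ≤ g := by
    have : 0 ≤ 1 - l := by linarith
    positivity
  have hy2 : y ^ 2 ≤ g * X := by
    have : y ^ 2 ≤ l * x₁ ^ 2 + (1 - l) * x₀ ^ 2 := by
      rw [hy]; nlinarith [mul_nonneg (mul_nonneg hl0 (sub_nonneg.2 hl1)) (sq_nonneg (x₁ - x₀))]
    have h2 := mul_le_mul_of_nonneg_left hx₁ hl0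
    have h3 := mul_le_mul_of_nonneg_left hx₀ (sub_nonneg.2 hl1)
    rw [hg]; nlinarith
  have hy0 : 0 ≤ y := by
    have : 0 ≤ 1 - l := by linarith
    positivity
  have e : l * x₁ + (1 - l) * (x₀ + b) = y + (1 - l) * b := by rw [hy]; ring
  rw [e]
  have hcs : y ^ 2 ≤ (Real.sqrt g * Real.sqrt X) ^ 2 := by
    rw [mul_pow, Real.sq_sqrt hg0, Real.sq_sqrt hX]; exact hy2
  have hcs' : y ≤ Real.sqrt g * Real.sqrt X := le_of_sq_le_sq hcs (by positivity)
  have h1l : 0 ≤ (1 - l) * b := mul_nonneg (by linarith) hb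
  calc (y + (1 - l) * b) ^ 2 ≤ (Real.sqrt g * Real.sqrt X + (1 - l) * b) ^ 2 := by
        apply pow_le_pow_left₀ (by positivity); linarith
    -- Cauchy–Schwarz for the vectors `(√g, 1 - l)` and `(√X, b)`.
    _ ≤ (Real.sqrt g ^ 2 + (1 - l) ^ 2) * (b ^ 2 + Real.sqrt X ^ 2) := by
        nlinarith [sq_nonneg (Real.sqrt g * b - (1 - l) * Real.sqrt X)]
    _ = _ := by rw [Real.sq_sqrt hg0, Real.sq_sqrt hX]

/-- The Hölder step in Talagrand's induction, with optimised interpolation parameter. -/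
theorem exists_interpolation_sum_le {ι : Type*} (s : Finset ι) (w f₀ f₁ : ι → ℝ)
    (hw : ∀ i ∈ s, 0 ≤ w i) {q₀ q₁ : ℝ} (hq₀ : 0 < q₀) (hq₁ : 0 < q₁) (hq : q₁ ≤ q₀)
    (h₀ : q₀ * ∑ i ∈ s, w i * Real.exp (f₀ i / 6) ≤ 1)
    (h₁ : q₁ * ∑ i ∈ s, w i * Real.exp (f₁ i / 6) ≤ 1) :
    ∃ l : ℝ, 0 ≤ l ∧ l ≤ 1 ∧
      ∑ i ∈ s, w i * Real.exp ((l * f₁ i + (1 - l) * f₀ i + (1 - l) ^ 2) / 6) ≤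
        (2 - q₁ / q₀) / q₀ := by
  obtain ⟨l, hl0, hl1, hl⟩ := exists_interpolation_exp_le (div_pos hq₁ hq₀)
    ((div_le_one hq₀).2 hq)
  refine ⟨l, hl0, hl1, ?_⟩
  rw [Real.log_div hq₁.ne' hq₀.ne'] at hl
  set K := Real.exp ((1 - l) ^ 2 / 6 - l * (Real.log q₁ - Real.log q₀)) with hK
  have key : ∀ i ∈ s, w i * Real.exp ((l * f₁ i + (1 - l) * f₀ i + (1 - l) ^ 2) / 6) ≤
      K / q₀ * (l * (q₁ * (w i * Real.exp (f₁ i / 6))) +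
        (1 - l) * (q₀ * (w i * Real.exp (f₀ i / 6)))) := by
    intro i hi
    -- The shifts by `log q₁` and `log q₀` normalise both sums to at most one, so summing this
    -- pointwise convexity inequality gives Hölder's inequality.
    have hc := convexOn_exp.2 (Set.mem_univ (f₁ i / 6 + Real.log q₁))
      (Set.mem_univ (f₀ i / 6 + Real.log q₀)) hl0 (sub_nonneg.2 hl1) (by ring)
    simp only [smul_eq_mul] at hc
    rw [Real.exp_add (f₁ i / 6), Real.exp_add (f₀ i / 6), Real.exp_log hq₁, Real.exp_log hq₀] at hc
    have e : Real.exp ((l * f₁ i + (1 - l) * f₀ i + (1 - l) ^ 2) / 6) =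
        K / q₀ * Real.exp (l * (f₁ i / 6 + Real.log q₁) + (1 - l) * (f₀ i / 6 + Real.log q₀)) := by
      have : q₀ = Real.exp (Real.log q₀) := (Real.exp_log hq₀).symm
      nth_rewrite 1 [this]
      rw [hK, ← Real.exp_sub, ← Real.exp_add]
      congr 1
      ring
    rw [e]
    have hKq : 0 ≤ K / q₀ := by positivity
    have := mul_le_mul_of_nonneg_left hc (mul_nonneg (hw i hi) hKq)
    linarith
  refine (Finset.sum_le_sum key).trans ?_
  rw [← Finset.mul_sum, Finset.sum_add_distrib, ← Finset.mul_sum, ← Finset.mul_sum,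
    ← Finset.mul_sum, ← Finset.mul_sum]
  have hS : l * (q₁ * ∑ i ∈ s, w i * Real.exp (f₁ i / 6)) +
      (1 - l) * (q₀ * ∑ i ∈ s, w i * Real.exp (f₀ i / 6)) ≤ 1 := by
    nlinarith [mul_le_mul_of_nonneg_left h₁ hl0,
      mul_le_mul_of_nonneg_left h₀ (sub_nonneg.2 hl1)]
  calc _ ≤ K / q₀ * 1 := mul_le_mul_of_nonneg_left hS (by positivity)
    _ = K / q₀ := mul_one _
    _ ≤ _ := by gcongr

theorem bernoulliProb_pos (hp0 : ∀ j, 0 ≤ p j) (hp1 : ∀ j, p j < 1) (s : Finset J)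
    {A : Set (Finset J)} (h : ∅ ∈ A) : 0 < bernoulliProb p s A := by
  classical
  unfold bernoulliProb
  refine Finset.sum_pos' (fun S _ => ?_) ⟨∅, by simp, ?_⟩
  · have := bernoulliWeight_nonneg hp0 hp1 s S
    split_ifs <;> simp [this]
  · have : 0 < bernoulliWeight p s ∅ := by
      simp only [bernoulliWeight, Finset.prod_empty, one_mul, Finset.sdiff_empty]
      exact Finset.prod_pos fun j _ => by linarith [hp1 j]
    simp [h, this]

theorem bernoulliProb_mono (hp0 : ∀ j, 0 ≤ p j) (hp1 : ∀ j, p j < 1) (s : Finset J)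
    {A B : Set (Finset J)} (h : A ⊆ B) : bernoulliProb p s A ≤ bernoulliProb p s B := by
  classical
  unfold bernoulliProb
  refine Finset.sum_le_sum fun S _ => mul_le_mul_of_nonneg_left ?_
    (bernoulliWeight_nonneg hp0 hp1 s S)
  by_cases hA : S ∈ A
  · simp [hA, h hA]
  · simp only [hA, if_false]; split_ifs <;> norm_num

/-- **Talagrand's convex distance inequality** for decreasing families on the discrete cube, with
the one-sided convex distance in its dual form. -/
theorem exists_convexDistance (hp0 : ∀ j, 0 ≤ p j) (hp1 : ∀ j, p j < 1) (s : Finset J) :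
    ∀ A : Set (Finset J), IsLowerSet A → ∅ ∈ A →
      ∃ f : Finset J → ℝ, (∀ S, 0 ≤ f S) ∧
        (∀ S ⊆ s, ∀ α : J → ℝ, (∀ j, 0 ≤ α j) →
          ∃ S' ∈ A, (∑ j ∈ S \ S', α j) ^ 2 ≤ f S * ∑ j ∈ S, α j ^ 2) ∧
        bernoulliProb p s A * ∑ S ∈ s.powerset, bernoulliWeight p s S * Real.exp (f S / 6) ≤ 1 := by
  classical
  induction s using Finset.induction_on with
  | empty =>
    intro A _ h
    refine ⟨fun _ => 0, fun _ => le_rfl, ?_, ?_⟩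
    · intro S hS α _
      exact ⟨∅, h, by simp [Finset.subset_empty.1 hS]⟩
    · simp [bernoulliProb, bernoulliWeight, h]
  | insert a s ha ih =>
    intro A hA h
    obtain ⟨f₀, hf₀, hd₀, hE₀⟩ := ih A hA h
    -- The section of `A` over sets containing `a`. A set `insert a T` may be compared with `insert
    -- a S₁` for `S₁ ∈ A₁`, at no cost for `a`, or with `S₀ ∈ A`, paying `α a`.
    set A₁ : Set (Finset J) := {S | insert a S ∈ A} with hA₁
    have hA₁low : IsLowerSet A₁ := fun S T hTS hS =>
      hA (Finset.insert_subset_insert a hTS) hS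
    have hA₁A : A₁ ⊆ A := fun S hS => hA (Finset.subset_insert a S) hS
    set q₀ := bernoulliProb p s A
    set q₁ := bernoulliProb p s A₁
    have hq₀ : 0 < q₀ := bernoulliProb_pos hp0 hp1 s h
    have hP : bernoulliProb p (insert a s) A = (1 - p a) * q₀ + p a * q₁ := by
      simp only [bernoulliProb, q₀, q₁]
      rw [sum_bernoulliWeight_insert ha]
      rfl
    have hq : q₁ ≤ q₀ := bernoulliProb_mono hp0 hp1 s hA₁A
    have hq₁0 : 0 ≤ q₁ := by
      refine Finset.sum_nonneg fun S _ => mul_nonneg (bernoulliWeight_nonneg hp0 hp1 s S) ?_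
      split_ifs <;> norm_num
    have hE₀' : ∑ S ∈ s.powerset, bernoulliWeight p s S * Real.exp (f₀ S / 6) ≤ 1 / q₀ := by
      rw [le_div_iff₀ hq₀]; linarith
    -- the extension of the dominating function to sets that contain `a`
    obtain ⟨g, hg0, hgd, hgE⟩ : ∃ g : Finset J → ℝ, (∀ S, 0 ≤ g S) ∧
        (∀ T ⊆ s, ∀ α : J → ℝ, (∀ j, 0 ≤ α j) →
          ∃ S' ∈ A, (∑ j ∈ insert a T \ S', α j) ^ 2 ≤ g T * ∑ j ∈ insert a T, α j ^ 2) ∧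
        ∑ S ∈ s.powerset, bernoulliWeight p s S * Real.exp (g S / 6) ≤ (2 - q₁ / q₀) / q₀ := by
      have hcost : ∀ T ⊆ s, ∀ α : J → ℝ, (∀ j, 0 ≤ α j) → ∀ S' : Finset J,
          ∑ j ∈ insert a T \ S', α j ≤ ∑ j ∈ T \ S', α j + α a := by
        intro T hT α hα S'
        have haT : a ∉ T \ S' := fun h => ha (hT (Finset.mem_sdiff.1 h).1)
        rw [add_comm, ← Finset.sum_insert haT]
        refine Finset.sum_le_sum_of_subset_of_nonneg ?_ fun j _ _ => hα j
        intro j; simp only [Finset.mem_sdiff, Finset.mem_insert]; tauto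
      by_cases h₁ : ∅ ∈ A₁
      · obtain ⟨f₁, hf₁, hd₁, hE₁⟩ := ih A₁ hA₁low h₁
        have hq₁ : 0 < q₁ := bernoulliProb_pos hp0 hp1 s h₁
        obtain ⟨l, hl0, hl1, hl⟩ := exists_interpolation_sum_le s.powerset
          (bernoulliWeight p s) f₀ f₁ (fun S _ => bernoulliWeight_nonneg hp0 hp1 s S)
          hq₀ hq₁ hq hE₀ hE₁
        have hl1' : 0 ≤ 1 - l := sub_nonneg.2 hl1
        refine ⟨fun S => l * f₁ S + (1 - l) * f₀ S + (1 - l) ^ 2, fun S => ?_, ?_, hl⟩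
        · have := hf₀ S; have := hf₁ S; positivity
        · intro T hT α hα
          have haT : a ∉ T := fun h => ha (hT h)
          obtain ⟨S₀, hS₀, hx₀⟩ := hd₀ T hT α hα
          obtain ⟨S₁, hS₁, hx₁⟩ := hd₁ T hT α hα
          have hcost₁ : ∑ j ∈ insert a T \ insert a S₁, α j ≤ ∑ j ∈ T \ S₁, α j := by
            refine Finset.sum_le_sum_of_subset_of_nonneg ?_ fun j _ _ => hα j
            intro j; simp only [Finset.mem_sdiff, Finset.mem_insert]; tauto
          have hcost₀ := hcost T hT α hα S₀
          have hI := interpolation_sq_le hl0 hl1 (hf₀ T) (hf₁ T)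
            (Finset.sum_nonneg fun j _ => sq_nonneg (α j)) (hα a)
            (Finset.sum_nonneg fun j _ => hα j) (Finset.sum_nonneg fun j _ => hα j) hx₀ hx₁
          rw [Finset.sum_insert haT]
          -- The cheaper of the two comparisons costs at most their convex combination. The
          -- parameter `l` depends on neither `T` nor `α`.
          rcases le_total (∑ j ∈ T \ S₁, α j) (∑ j ∈ T \ S₀, α j + α a) with hle | hle
          · refine ⟨insert a S₁, hS₁, le_trans ?_ hI⟩
            refine pow_le_pow_left₀ (Finset.sum_nonneg fun j _ => hα j) ?_ 2
            nlinarith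
          · refine ⟨S₀, hS₀, le_trans ?_ hI⟩
            refine pow_le_pow_left₀ (Finset.sum_nonneg fun j _ => hα j) ?_ 2
            nlinarith
      -- No member of `A` contains `a`, so `α a` must be paid in full: this is `l = 0`, and `exp (1
      -- / 6) ≤ 2` replaces the optimisation.
      · have hq₁ : q₁ = 0 := by
          refine Finset.sum_eq_zero fun S _ => ?_
          have : S ∉ A₁ := fun hS => h₁ (hA₁low (Finset.empty_subset S) hS)
          simp [this]
        refine ⟨fun S => f₀ S + 1, fun S => by linarith [hf₀ S], ?_, ?_⟩
        · intro T hT α hα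
          have haT : a ∉ T := fun h => ha (hT h)
          obtain ⟨S₀, hS₀, hx₀⟩ := hd₀ T hT α hα
          have hcost₀ := hcost T hT α hα S₀
          have hI := interpolation_sq_le (l := 0) (x₁ := 0) le_rfl zero_le_one (hf₀ T) le_rfl
            (Finset.sum_nonneg fun j _ => sq_nonneg (α j)) (hα a)
            (Finset.sum_nonneg fun j _ => hα j) le_rfl hx₀ (by simp)
          refine ⟨S₀, hS₀, ?_⟩
          rw [Finset.sum_insert haT]
          norm_num at hI
          exact (pow_le_pow_left₀ (Finset.sum_nonneg fun j _ => hα j) hcost₀ 2).trans hI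
        · have hexp : Real.exp (1 / 6 : ℝ) ≤ 2 := by
            have h := Real.abs_exp_sub_one_sub_id_le (x := (1 / 6 : ℝ))
              (by rw [abs_of_nonneg] <;> norm_num)
            have := (abs_le.1 h).2
            norm_num at this ⊢; linarith
          have : ∀ S ∈ s.powerset, bernoulliWeight p s S * Real.exp ((f₀ S + 1) / 6) =
              Real.exp (1 / 6) * (bernoulliWeight p s S * Real.exp (f₀ S / 6)) := by
            intro S _
            rw [add_div, Real.exp_add]; ring
          rw [Finset.sum_congr rfl this, ← Finset.mul_sum, hq₁, zero_div, sub_zero]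
          calc _ ≤ 2 * (1 / q₀) := mul_le_mul hexp hE₀' (Finset.sum_nonneg fun S _ =>
                mul_nonneg (bernoulliWeight_nonneg hp0 hp1 s S) (Real.exp_pos _).le) (by norm_num)
            _ = _ := by ring
    refine ⟨fun S => if a ∈ S then g (S.erase a) else f₀ S, fun S => ?_, ?_, ?_⟩
    · dsimp only
      split_ifs
      · exact hg0 _
      · exact hf₀ _
    · intro S hS α hα
      by_cases haS : a ∈ S
      · simp only [haS, if_true]
        have := hgd (S.erase a) (Finset.subset_insert_iff.1 hS) α hα
        rwa [Finset.insert_erase haS] at this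
      · simp only [haS, if_false]
        exact hd₀ S ((Finset.subset_insert_iff_of_notMem haS).1 hS) α hα
    · rw [sum_bernoulliWeight_insert ha, hP]
      have e₀ : ∑ S ∈ s.powerset, bernoulliWeight p s S *
          Real.exp ((if a ∈ S then g (S.erase a) else f₀ S) / 6) =
          ∑ S ∈ s.powerset, bernoulliWeight p s S * Real.exp (f₀ S / 6) := by
        refine Finset.sum_congr rfl fun S hS => ?_
        have : a ∉ S := fun h => ha (Finset.mem_powerset.1 hS h)
        simp [this]
      have e₁ : ∑ S ∈ s.powerset, bernoulliWeight p s S *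
          Real.exp ((if a ∈ insert a S then g ((insert a S).erase a) else f₀ (insert a S)) / 6) =
          ∑ S ∈ s.powerset, bernoulliWeight p s S * Real.exp (g S / 6) := by
        refine Finset.sum_congr rfl fun S hS => ?_
        have : a ∉ S := fun h => ha (Finset.mem_powerset.1 hS h)
        simp [this]
      rw [e₀, e₁]
      have hpa := hp0 a
      have hpa1 : 0 ≤ 1 - p a := by linarith [hp1 a]
      have hx : 0 ≤ (1 - p a) * q₀ + p a * q₁ := by positivity
      calc ((1 - p a) * q₀ + p a * q₁) * _
          ≤ ((1 - p a) * q₀ + p a * q₁) *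
            ((1 - p a) * (1 / q₀) + p a * ((2 - q₁ / q₀) / q₀)) := by gcongr
        -- With `x` the ratio of the new probability of `A` to `q₀`, the product is `x (2 - x) ≤ 1`.
        _ = (1 - p a + p a * (q₁ / q₀)) * (2 - (1 - p a + p a * (q₁ / q₀))) := by
            field_simp; ring
        _ ≤ 1 := by nlinarith [sq_nonneg (1 - p a + p a * (q₁ / q₀) - 1)]

end BernoulliCube

/-! ### Edge counts of random induced subgraphs -/

section FiniteGraph

open Classical in
/-- The number of elements of `S` that are related to `j`. -/
noncomputable def degreeIn {J : Type*} (r : J → J → Prop) (S : Finset J) (j : J) : ℕ :=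
  (S.filter (r j)).card

/-- The number of ordered related pairs in `S`. -/
noncomputable def pairCount {J : Type*} (r : J → J → Prop) (S : Finset J) : ℕ :=
  ∑ j ∈ S, degreeIn r S j

variable {J : Type*} {r : J → J → Prop}

theorem degreeIn_mono {S T : Finset J} (h : S ⊆ T) (j : J) : degreeIn r S j ≤ degreeIn r T j :=
  by classical exact Finset.card_le_card (Finset.filter_subset_filter _ h)

theorem pairCount_mono {S T : Finset J} (h : S ⊆ T) : pairCount r S ≤ pairCount r T :=
  (Finset.sum_le_sum fun j _ => degreeIn_mono h j).trans
    (Finset.sum_le_sum_of_subset h)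

/-- A related pair of `S` not contained in `S'` has an end in `S \ S'`. Charging it to the degree of
that end uses symmetry and counts each of the two orders once, whence the factor 2. -/
theorem pairCount_le_add [DecidableEq J] (hr : ∀ j k, r j k → r k j) (S S' : Finset J) :
    pairCount r S ≤ pairCount r S' + 2 * ∑ j ∈ S \ S', degreeIn r S j := by
  classical
  have hdeg : ∀ (T : Finset J) j, degreeIn r T j = ∑ k ∈ T, if r j k then 1 else 0 := fun T j => by
    rw [degreeIn, Finset.card_filter]
  have h1 : pairCount r S = ∑ j ∈ S \ S', degreeIn r S j + ∑ j ∈ S ∩ S', degreeIn r S j := by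
    rw [pairCount, ← Finset.sum_inter_add_sum_sdiff S S', add_comm]
  have h2 : ∑ j ∈ S ∩ S', degreeIn r S j =
      pairCount r (S ∩ S') + ∑ j ∈ S ∩ S', degreeIn r (S \ S') j := by
    rw [pairCount, ← Finset.sum_add_distrib]
    refine Finset.sum_congr rfl fun j _ => ?_
    rw [hdeg, hdeg, hdeg, Finset.sum_inter_add_sum_sdiff]
  have h3 : ∑ j ∈ S ∩ S', degreeIn r (S \ S') j ≤ ∑ j ∈ S \ S', degreeIn r S j := by
    simp only [hdeg]
    rw [Finset.sum_comm]
    refine Finset.sum_le_sum fun k _ => ?_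
    refine (Finset.sum_le_sum_of_subset (Finset.inter_subset_left (s₂ := S'))).trans ?_
    refine Finset.sum_le_sum fun j _ => ?_
    by_cases h : r j k
    · simp [h, hr _ _ h]
    · simp [h]
  have h4 : pairCount r (S ∩ S') ≤ pairCount r S' := pairCount_mono Finset.inter_subset_right
  omega

/-- The function `x ↦ (x - a)² / x` is increasing on `[a, ∞)`. -/
theorem sq_sub_div_mono {a b x : ℝ} (ha : 0 ≤ a) (hab : a < b) (hbx : b ≤ x) :
    (b - a) ^ 2 / b ≤ (x - a) ^ 2 / x := by
  have hb : 0 < b := ha.trans_lt hab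
  have hx : 0 < x := hb.trans_le hbx
  rw [div_le_div_iff₀ hb hx]
  have : 0 ≤ (x - b) * (x * b - a ^ 2) := by
    apply mul_nonneg (by linarith)
    nlinarith
  nlinarith

/-- Concentration of the number of related pairs of a random subset on the event that all
degrees are bounded. -/
theorem bernoulliProb_pairCount_mul_le [DecidableEq J] {p : J → ℝ} (hp0 : ∀ j, 0 ≤ p j)
    (hp1 : ∀ j, p j < 1) (s : Finset J) (hr : ∀ j k, r j k → r k j) {a b D : ℝ} (ha : 0 ≤ a)
    (hab : a < b) (hD : 0 < D) :
    bernoulliProb p s {S | (pairCount r S : ℝ) ≤ 2 * a} *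
      bernoulliProb p s {S | 2 * b ≤ pairCount r S ∧ ∀ j ∈ S, (degreeIn r S j : ℝ) ≤ D} ≤
        Real.exp (-((b - a) ^ 2 / (12 * D * b))) := by
  classical
  have hb : 0 < b := ha.trans_lt hab
  set A : Set (Finset J) := {S | (pairCount r S : ℝ) ≤ 2 * a} with hA
  set B : Set (Finset J) := {S | 2 * b ≤ pairCount r S ∧ ∀ j ∈ S, (degreeIn r S j : ℝ) ≤ D} with hB
  have hlow : IsLowerSet A := fun S T hTS hS => by
    have : (pairCount r T : ℝ) ≤ pairCount r S := by exact_mod_cast pairCount_mono hTS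
    exact this.trans hS
  have h0 : ∅ ∈ A := by simp only [hA, Set.mem_ofPred_eq, pairCount]; simp; linarith
  obtain ⟨f, hf0, hfd, hfE⟩ := exists_convexDistance hp0 hp1 s A hlow h0
  have hfB : ∀ S ⊆ s, S ∈ B → (b - a) ^ 2 / (2 * D * b) ≤ f S := by
    rintro S hS ⟨hSb, hSD⟩
    -- The dual form of the convex distance is tested with the degrees as weights; their squares sum
    -- to at most `D` times their sum, which is `2 * x`.
    obtain ⟨S', hS', hle⟩ := hfd S hS (fun j => (degreeIn r S j : ℝ)) (fun j => Nat.cast_nonneg _)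
    set x : ℝ := (pairCount r S : ℝ) / 2 with hx
    have hbx : b ≤ x := by rw [hx]; linarith
    have h1 : (pairCount r S : ℝ) ≤
        pairCount r S' + 2 * ∑ j ∈ S \ S', (degreeIn r S j : ℝ) := by
      exact_mod_cast pairCount_le_add hr S S'
    have hS'' : (pairCount r S' : ℝ) ≤ 2 * a := hS'
    have h2 : (x - a) ^ 2 ≤ (∑ j ∈ S \ S', (degreeIn r S j : ℝ)) ^ 2 := by
      apply pow_le_pow_left₀ (by linarith); rw [hx]; linarith
    have h3 : ∑ j ∈ S, (degreeIn r S j : ℝ) ^ 2 ≤ D * (2 * x) := by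
      have : (2 * x) = ∑ j ∈ S, (degreeIn r S j : ℝ) := by
        rw [hx, pairCount]; push_cast; ring
      rw [this, Finset.mul_sum]
      refine Finset.sum_le_sum fun j hj => ?_
      rw [sq]
      exact mul_le_mul_of_nonneg_right (hSD j hj) (Nat.cast_nonneg _)
    have hx0 : 0 < x := hb.trans_le hbx
    have h4 : (x - a) ^ 2 ≤ f S * (D * (2 * x)) :=
      h2.trans (hle.trans (mul_le_mul_of_nonneg_left h3 (hf0 S)))
    have h5 := sq_sub_div_mono ha hab hbx
    have h6 : (x - a) ^ 2 / x ≤ f S * (2 * D) := by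
      rw [div_le_iff₀ hx0]; linarith
    calc (b - a) ^ 2 / (2 * D * b) = (b - a) ^ 2 / b / (2 * D) := by field_simp
      _ ≤ f S * (2 * D) / (2 * D) := by gcongr; exact h5.trans h6
      _ = f S := by field_simp
  have hPA : 0 ≤ bernoulliProb p s A := (bernoulliProb_pos hp0 hp1 s h0).le
  -- Markov's inequality for `exp (f / 6)`, using the lower bound for `f` on `B`.
  have hBE : bernoulliProb p s B * Real.exp ((b - a) ^ 2 / (12 * D * b)) ≤
      ∑ S ∈ s.powerset, bernoulliWeight p s S * Real.exp (f S / 6) := by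
    rw [bernoulliProb, Finset.sum_mul]
    refine Finset.sum_le_sum fun S hS => ?_
    rw [mul_assoc]
    refine mul_le_mul_of_nonneg_left ?_ (bernoulliWeight_nonneg hp0 hp1 s S)
    by_cases hSB : S ∈ B
    · simp only [hSB, if_true, one_mul]
      apply Real.exp_le_exp.2
      have := hfB S (Finset.mem_powerset.1 hS) hSB
      calc (b - a) ^ 2 / (12 * D * b) = (b - a) ^ 2 / (2 * D * b) / 6 := by field_simp; ring
        _ ≤ _ := by gcongr
    · simp [hSB, Real.exp_nonneg]
  have h7 := (mul_le_mul_of_nonneg_left hBE hPA).trans hfE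
  rw [Real.exp_neg, ← one_div, le_div_iff₀ (Real.exp_pos _)]
  linarith

end FiniteGraph

/-! ### Occupied indices as a Bernoulli subset -/

section RandomSubset

variable {Ω J : Type*} [MeasurableSpace Ω] {P : Measure Ω} [IsProbabilityMeasure P]
  [Fintype J] [DecidableEq J]

open Classical in
/-- The (finite) set of indices with nonzero count. -/
noncomputable def occupied (X : J → ℕ∞) : Finset J := Finset.univ.filter fun j => X j ≠ 0

/-- The events that the individual counts vanish are independent, so the pattern of occupied indices
has a product law. -/
theorem measureReal_occupied_eq {X : J → Ω → ℕ∞} (hX : ∀ j, Measurable (X j))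
    (hI : iIndepFun X P) (E : Set (Finset J)) :
    P.real {ω | occupied (fun j => X j ω) ∈ E} =
      bernoulliProb (fun j => P.real {ω | X j ω ≠ 0}) Finset.univ E := by
  classical
  have hms : ∀ j, MeasurableSet {ω | X j ω ≠ 0} := fun j =>
    (hX j) (MeasurableSet.singleton (0 : ℕ∞)).compl
  have hset : ∀ S : Finset J, {ω | occupied (fun j => X j ω) = S} =
      ⋂ j, X j ⁻¹' (if j ∈ S then {0}ᶜ else {0}) := by
    intro S
    ext ω
    simp only [Set.mem_ofPred_eq, Set.mem_iInter, Set.mem_preimage, Finset.ext_iff, occupied,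
      Finset.mem_filter, Finset.mem_univ, true_and]
    refine forall_congr' fun j => ?_
    by_cases hj : j ∈ S <;> simp [hj]
  have hmeas : ∀ S : Finset J, MeasurableSet {ω | occupied (fun j => X j ω) = S} := by
    intro S
    rw [hset]
    refine MeasurableSet.iInter fun j => (hX j) ?_
    split_ifs <;> measurability
  have hw : ∀ S : Finset J, P.real {ω | occupied (fun j => X j ω) = S} =
      bernoulliWeight (fun j => P.real {ω | X j ω ≠ 0}) Finset.univ S := by
    intro S
    have h := hI.measure_inter_preimage_eq_mul Finset.univ
      (sets := fun j => if j ∈ S then {0}ᶜ else {0}) (fun j _ => by split_ifs <;> measurability)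
    simp only [Finset.mem_univ, Set.iInter_true] at h
    rw [measureReal_def, hset, h, ENNReal.toReal_prod, bernoulliWeight,
      ← Finset.prod_sdiff (Finset.subset_univ S), mul_comm]
    congr 1
    · refine Finset.prod_congr rfl fun j hj => ?_
      simp only [hj, if_true]
      rfl
    · refine Finset.prod_congr rfl fun j hj => ?_
      rw [← probReal_compl_eq_one_sub (hms j), measureReal_def]
      have : j ∉ S := (Finset.mem_sdiff.1 hj).2
      simp only [this, if_false]
      congr 2
      ext ω; simp
  have hE : {ω | occupied (fun j => X j ω) ∈ E} =
      ⋃ S ∈ Finset.univ.filter (· ∈ E), {ω | occupied (fun j => X j ω) = S} := by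
    ext ω; simp
  rw [hE, measureReal_biUnion_finset _ fun S _ => hmeas S]
  · rw [bernoulliProb, Finset.powerset_univ, Finset.sum_filter]
    refine Finset.sum_congr rfl fun S _ => ?_
    rw [hw]
    split_ifs <;> simp
  · intro S _ T _ hST
    refine Set.disjoint_left.2 fun ω h1 h2 => hST ?_
    exact h1.symm.trans h2

end RandomSubset

/-! ### Factorial moments, tails and restrictions of Poisson processes -/

section PoissonCounts

theorem lintegral_poissonMeasure (r : ℝ≥0) (f : ℕ → ℝ≥0∞) :
    ∫⁻ n, f n ∂(poissonMeasure r) =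
      ∑' n : ℕ, ENNReal.ofReal (Real.exp (-r) * r ^ n / n.factorial) * f n := by
  rw [poissonMeasure, lintegral_sum_measure]
  simp

/-- The factorial moments of the Poisson distribution. -/
theorem lintegral_descFactorial_poissonMeasure (r : ℝ≥0) (k : ℕ) :
    ∫⁻ n, (n.descFactorial k : ℝ≥0∞) ∂(poissonMeasure r) = (r : ℝ≥0∞) ^ k := by
  -- The terms below `k` vanish, and `(m + k)! = m! * (m + k).descFactorial k` turns the shifted
  -- series into `r ^ k` times the total mass.
  rw [lintegral_poissonMeasure, ← ENNReal.summable.sum_add_tsum_nat_add' (k := k)]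
  have h0 : ∑ n ∈ Finset.range k, ENNReal.ofReal (Real.exp (-r) * r ^ n / n.factorial) *
      (n.descFactorial k : ℝ≥0∞) = 0 := by
    refine Finset.sum_eq_zero fun n hn => ?_
    rw [Nat.descFactorial_of_lt (Finset.mem_range.1 hn)]
    simp
  have h1 : ∀ m : ℕ, ENNReal.ofReal (Real.exp (-r) * r ^ (m + k) / (m + k).factorial) *
      ((m + k).descFactorial k : ℝ≥0∞) =
      (r : ℝ≥0∞) ^ k * (ENNReal.ofReal (Real.exp (-r) * r ^ m / m.factorial) * 1) := by
    intro m
    have hr : (r : ℝ≥0∞) ^ k = ENNReal.ofReal ((r : ℝ) ^ k) := by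
      rw [ENNReal.ofReal_pow r.coe_nonneg, ENNReal.ofReal_coe_nnreal]
    rw [hr, ← ENNReal.ofReal_natCast, mul_one, ← ENNReal.ofReal_mul (by positivity),
      ← ENNReal.ofReal_mul (by positivity)]
    congr 1
    have h := Nat.factorial_mul_descFactorial (Nat.le_add_left k m)
    rw [Nat.add_sub_cancel] at h
    have h' : ((m + k).factorial : ℝ) = m.factorial * (m + k).descFactorial k := by
      exact_mod_cast h.symm
    have hd : ((m + k).descFactorial k : ℝ) ≠ 0 := by
      have : 0 < (m + k).descFactorial k := Nat.descFactorial_pos.2 (Nat.le_add_left k m)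
      positivity
    rw [h']
    have := Nat.factorial_pos m
    field_simp
    ring
  simp_rw [h0, h1]
  rw [ENNReal.tsum_mul_left, ← lintegral_poissonMeasure r (fun _ => 1)]
  simp

variable {Ω X : Type*} [MeasurableSpace Ω] [MeasurableSpace X] {η : Ω → Set X} {μ : Measure X}
  {P : Measure Ω}

theorem IsPoissonProcess.lintegral_descFactorial (h : IsPoissonProcess η μ P) {A : Set X}
    (hA : MeasurableSet A) (hfin : μ A ≠ ∞) (k : ℕ) :
    ∫⁻ ω, ((η ω ∩ A).ncard.descFactorial k : ℝ≥0∞) ∂P = μ A ^ k := by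
  have e : ∀ ω, ((η ω ∩ A).ncard.descFactorial k : ℝ≥0∞) =
      (fun n : ℕ∞ => (n.toNat.descFactorial k : ℝ≥0∞)) (η ω ∩ A).encard := fun ω => rfl
  simp_rw [e]
  rw [← lintegral_map (μ := P) (f := fun n : ℕ∞ => (n.toNat.descFactorial k : ℝ≥0∞))
    Measurable.of_discrete (h.measurable_count A hA), h.map_count A hA hfin,
    lintegral_map Measurable.of_discrete Measurable.of_discrete]
  simp only [ENat.toNat_natCast]
  rw [lintegral_descFactorial_poissonMeasure, ENNReal.coe_toNNReal hfin]

theorem IsPoissonProcess.ae_finite (h : IsPoissonProcess η μ P) {A : Set X}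
    (hA : MeasurableSet A) (hfin : μ A ≠ ∞) : ∀ᵐ ω ∂P, (η ω ∩ A).Finite := by
  have : ∀ᵐ n ∂(P.map fun ω => (η ω ∩ A).encard), n ≠ ⊤ := by
    rw [h.map_count A hA hfin, ae_map_iff Measurable.of_discrete.aemeasurable
      (MeasurableSet.of_discrete (s := {n : ℕ∞ | n ≠ ⊤}))]
    simp
  filter_upwards [ae_of_ae_map (h.measurable_count A hA).aemeasurable this] with ω hω
  exact Set.encard_ne_top_iff.1 hω

/-- Markov's inequality for the `k`-th factorial moment, which is at least `k!` as soon as there are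
`k` points. -/
theorem IsPoissonProcess.measure_le_encard (h : IsPoissonProcess η μ P) {A : Set X}
    (hA : MeasurableSet A) (hfin : μ A ≠ ∞) (k : ℕ) :
    P {ω | (k : ℕ∞) ≤ (η ω ∩ A).encard} ≤ μ A ^ k / k.factorial := by
  have hm := h.measurable_count A hA
  have hmeas : Measurable fun ω => ((η ω ∩ A).ncard.descFactorial k : ℝ≥0∞) :=
    (Measurable.of_discrete (f := fun n : ℕ∞ => (n.toNat.descFactorial k : ℝ≥0∞))).comp hm
  have h1 := mul_meas_ge_le_lintegral (μ := P) hmeas (k.factorial : ℝ≥0∞)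
  rw [h.lintegral_descFactorial hA hfin] at h1
  rw [ENNReal.le_div_iff_mul_le (Or.inl (by simp [Nat.factorial_ne_zero])) (Or.inl (by simp)),
    mul_comm]
  refine le_trans ?_ h1
  refine mul_le_mul_right (measure_mono_ae ?_) _
  -- An infinite configuration would have `ncard = 0` and violate the inclusion, so it is discarded
  -- as a null event.
  filter_upwards [h.ae_finite hA hfin] with ω hω hk
  have hk' : (k : ℕ∞) ≤ (η ω ∩ A).encard := hk
  rw [← hω.cast_ncard_eq, Nat.cast_le] at hk'
  change (k.factorial : ℝ≥0∞) ≤ ((η ω ∩ A).ncard.descFactorial k : ℝ≥0∞)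
  rw [Nat.cast_le, ← Nat.descFactorial_self]
  exact Nat.descFactorial_le k hk'

theorem IsPoissonProcess.measure_encard_eq_zero (h : IsPoissonProcess η μ P) {A : Set X}
    (hA : MeasurableSet A) (hfin : μ A ≠ ∞) :
    P {ω | (η ω ∩ A).encard = 0} = ENNReal.ofReal (Real.exp (-(μ A).toReal)) := by
  have e : {ω | (η ω ∩ A).encard = 0} = (fun ω => (η ω ∩ A).encard) ⁻¹' {0} := rfl
  rw [e, ← Measure.map_apply (h.measurable_count A hA) (MeasurableSet.singleton _),
    h.map_count A hA hfin, Measure.map_apply Measurable.of_discrete (MeasurableSet.singleton _)]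
  have : (fun n : ℕ => (n : ℕ∞)) ⁻¹' {0} = {0} := by ext; simp
  rw [this, poissonMeasure_singleton]
  simp [ENNReal.toReal]

theorem IsPoissonProcess.measure_encard_ne_zero_le (h : IsPoissonProcess η μ P) {A : Set X}
    (hA : MeasurableSet A) (hfin : μ A ≠ ∞) : P {ω | (η ω ∩ A).encard ≠ 0} ≤ μ A := by
  have := h.measure_le_encard hA hfin 1
  simp only [Nat.cast_one, pow_one, Nat.factorial_one, div_one] at this
  simpa [Order.one_le_iff_ne_zero] using this

/-- Finitely many disjoint measurable sets have independent counts. -/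
theorem IsPoissonProcess.iIndepFun_encard (h : IsPoissonProcess η μ P) {ι : Type*} [Fintype ι]
    (A : ι → Set X) (hA : ∀ i, MeasurableSet (A i)) (hd : Pairwise (Function.onFun Disjoint A)) :
    iIndepFun (fun i ω => (η ω ∩ A i).encard) P := by
  let e := Fintype.equivFin ι
  have h1 := h.indep_count _ (A ∘ e.symm) (fun j => hA _)
    (fun i j hij => hd (e.symm.injective.ne hij))
  have h2 := h1.precomp (g := e) e.injective
  simpa using h2

theorem IsPoissonProcess.indepFun_encard (h : IsPoissonProcess η μ P) {A B : Set X}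
    (hA : MeasurableSet A) (hB : MeasurableSet B) (hd : Disjoint A B) :
    IndepFun (fun ω => (η ω ∩ A).encard) (fun ω => (η ω ∩ B).encard) P := by
  have h1 := h.iIndepFun_encard (fun b : Bool => cond b A B) (by rintro (_ | _) <;> assumption)
    (by
      rintro (_ | _) (_ | _) hij
      · exact absurd rfl hij
      · exact hd.symm
      · exact hd
      · exact absurd rfl hij)
  exact h1.indepFun (i := true) (j := false) (by simp)

/-- The restriction of a Poisson process to a set of finite intensity has a version all of whose
realisations are finite. -/
theorem IsPoissonProcess.exists_finset_restrict (h : IsPoissonProcess η μ P) {V : Set X}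
    (hV : MeasurableSet V) (hfin : μ V ≠ ∞) :
    ∃ ζ : Ω → Finset X, IsPoissonProcess (fun ω => (ζ ω : Set X)) (μ.restrict V) P ∧
      ∀ᵐ ω ∂P, (ζ ω : Set X) = η ω ∩ V := by
  classical
  let ζ : Ω → Finset X := fun ω => if hf : (η ω ∩ V).Finite then hf.toFinset else ∅
  have hζ : ∀ ω, (η ω ∩ V).Finite → (ζ ω : Set X) = η ω ∩ V := fun ω hf => by simp [ζ, hf]
  have hae : ∀ᵐ ω ∂P, (ζ ω : Set X) = η ω ∩ V := by
    filter_upwards [h.ae_finite hV hfin] with ω hω using hζ ω hω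
  have hcount : ∀ A : Set X, (fun ω => ((ζ ω : Set X) ∩ A).encard) =ᵐ[P]
      fun ω => (η ω ∩ (A ∩ V)).encard := by
    intro A
    filter_upwards [hae] with ω hω
    rw [hω, Set.inter_assoc, Set.inter_comm V A]
  have hfinA : ∀ A, μ (A ∩ V) ≠ ∞ := fun A => measure_ne_top_of_subset Set.inter_subset_right hfin
  refine ⟨ζ, ⟨?_, ?_, ?_, ?_⟩, hae⟩
  · intro A hA
    -- Measurability is required at every `ω`, not just almost surely, so the default `∅` on
    -- infinite realisations enters as the value 0.
    have e : (fun ω => ((ζ ω : Set X) ∩ A).encard) =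
        fun ω => if (η ω ∩ V).encard ≠ ⊤ then (η ω ∩ (A ∩ V)).encard else 0 := by
      ext ω
      by_cases hf : (η ω ∩ V).Finite
      · rw [hζ ω hf, if_pos (Set.encard_ne_top_iff.2 hf), Set.inter_assoc, Set.inter_comm V A]
      · rw [if_neg (by simpa [Set.encard_eq_top_iff] using hf)]
        simp [ζ, hf]
    rw [e]
    refine Measurable.ite ?_ (h.measurable_count _ (hA.inter hV)) measurable_const
    exact (h.measurable_count V hV) (MeasurableSet.of_discrete (s := {n : ℕ∞ | n ≠ ⊤}))
  · intro A hA _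
    rw [Measure.restrict_apply hA, Measure.map_congr (hcount A)]
    exact h.map_count _ (hA.inter hV) (hfinA A)
  · intro A hA hA'
    rw [Measure.restrict_apply hA] at hA'
    exact absurd hA' (hfinA A)
  · intro n A hA hd
    refine iIndepFun.congr (fun j => (hcount (A j)).symm) ?_
    exact h.indep_count n (fun j => A j ∩ V) (fun j => (hA j).inter hV)
      (fun i j hij => (hd hij).mono Set.inter_subset_left Set.inter_subset_left)

end PoissonCounts

/-! ### Dyadic cells and the algebra of their products -/

section Cells

variable {X : Type*} [MeasurableSpace X] [MeasurableSpace.CountablyGenerated X]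

/-- The index of the cell of the `n`-th dyadic partition that contains `x`: the partition is
generated by the first `n` members of a generating sequence of the `σ`-algebra. -/
noncomputable def cellMap (n : ℕ) (x : X) : Fin n → Bool :=
  fun i => MeasurableSpace.mapNatBool X x i

theorem measurable_cellMap (n : ℕ) : Measurable (cellMap n : X → Fin n → Bool) :=
  measurable_pi_iff.2 fun i =>
    (measurable_pi_apply (i : ℕ)).comp (MeasurableSpace.measurable_mapNatBool X)

theorem measurableSet_cell (n : ℕ) (a : Fin n → Bool) :
    MeasurableSet (cellMap n ⁻¹' {a} : Set X) :=
  measurable_cellMap n (MeasurableSet.singleton a)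

theorem measurable_cellMap_prod (n : ℕ) :
    Measurable fun q : X × X => (cellMap n q.1, cellMap n q.2) :=
  ((measurable_cellMap n).comp measurable_fst).prodMk ((measurable_cellMap n).comp measurable_snd)

variable (X) in
/-- The algebra of finite unions of products of cells. -/
def cellAlgebra : Set (Set (X × X)) :=
  {S | ∃ (n : ℕ) (r : Set ((Fin n → Bool) × (Fin n → Bool))),
    S = (fun q : X × X => (cellMap n q.1, cellMap n q.2)) ⁻¹' r}

/-- The partitions are nested: the coarse label consists of the first `n` bits of the fine one. -/
theorem exists_refined_relation {n m : ℕ} (h : n ≤ m) (r : Set ((Fin n → Bool) × (Fin n → Bool))) :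
    ∃ r' : Set ((Fin m → Bool) × (Fin m → Bool)),
      (fun q : X × X => (cellMap n q.1, cellMap n q.2)) ⁻¹' r =
        (fun q : X × X => (cellMap m q.1, cellMap m q.2)) ⁻¹' r' :=
  ⟨{c | (fun i => c.1 (Fin.castLE h i), fun i => c.2 (Fin.castLE h i)) ∈ r}, rfl⟩

theorem isSetAlgebra_cellAlgebra : IsSetAlgebra (cellAlgebra X) where
  empty_mem := ⟨0, ∅, by simp⟩
  compl_mem := by
    rintro _ ⟨n, r, rfl⟩
    exact ⟨n, rᶜ, rfl⟩
  union_mem := by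
    rintro _ _ ⟨n, r, rfl⟩ ⟨m, s, rfl⟩
    obtain ⟨r', hr'⟩ := exists_refined_relation (X := X) (le_max_left n m) r
    obtain ⟨s', hs'⟩ := exists_refined_relation (X := X) (le_max_right n m) s
    exact ⟨max n m, r' ∪ s', by rw [hr', hs', Set.preimage_union]⟩

theorem generateFrom_cellAlgebra :
    (inferInstance : MeasurableSpace (X × X)) = MeasurableSpace.generateFrom (cellAlgebra X) := by
  apply le_antisymm
  · have hm : ‹MeasurableSpace X› =
        MeasurableSpace.generateFrom (Set.range (MeasurableSpace.natGeneratingSequence X)) :=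
      (MeasurableSpace.generateFrom_natGeneratingSequence X).symm
    refine sup_le ?_ ?_
    · conv_lhs => rw [hm]
      rw [MeasurableSpace.comap_generateFrom]
      refine MeasurableSpace.generateFrom_le ?_
      rintro _ ⟨_, ⟨k, rfl⟩, rfl⟩
      -- The `k`-th generator is the last bit of the label at level `k + 1`.
      refine MeasurableSpace.measurableSet_generateFrom
        ⟨k + 1, {c | c.1 (Fin.last k) = true}, ?_⟩
      ext q
      simp [cellMap, MeasurableSpace.mapNatBool]
    · conv_lhs => rw [hm]
      rw [MeasurableSpace.comap_generateFrom]
      refine MeasurableSpace.generateFrom_le ?_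
      rintro _ ⟨_, ⟨k, rfl⟩, rfl⟩
      refine MeasurableSpace.measurableSet_generateFrom
        ⟨k + 1, {c | c.2 (Fin.last k) = true}, ?_⟩
      ext q
      simp [cellMap, MeasurableSpace.mapNatBool]
  · refine MeasurableSpace.generateFrom_le ?_
    rintro _ ⟨n, r, rfl⟩
    exact measurable_cellMap_prod n r.toFinite.measurableSet

open Classical in
theorem measure_cellMap_prod_preimage (ν : Measure (X × X)) {n : ℕ}
    (r : Set ((Fin n → Bool) × (Fin n → Bool))) :
    ν ((fun q : X × X => (cellMap n q.1, cellMap n q.2)) ⁻¹' r) =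
      ∑ c ∈ Finset.univ.filter (· ∈ r),
        ν ((cellMap n ⁻¹' {c.1}) ×ˢ (cellMap n ⁻¹' {c.2})) := by
  have h := sum_measure_preimage_singleton (μ := ν) (Finset.univ.filter (· ∈ r))
    (f := fun q : X × X => (cellMap n q.1, cellMap n q.2))
    (fun c _ => measurable_cellMap_prod n (MeasurableSet.singleton c))
  rw [Finset.coe_filter_univ] at h
  rw [show r = {c | c ∈ r} from rfl, ← h]
  refine Finset.sum_congr rfl fun c _ => ?_
  congr 1
  ext q
  simp [Prod.ext_iff]

theorem measurableSet_sameCell (n : ℕ) :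
    MeasurableSet {q : X × X | cellMap n q.1 = cellMap n q.2} :=
  measurable_cellMap_prod n (Set.toFinite {c : (Fin n → Bool) × (Fin n → Bool) | c.1 = c.2}).measurableSet

theorem antitone_sameCell : Antitone fun n => {q : X × X | cellMap n q.1 = cellMap n q.2} := by
  intro n m hnm q hq
  funext i
  exact congrFun (show cellMap m q.1 = cellMap m q.2 from hq) (Fin.castLE hnm i)

/-- The pairs on which a relation between points is not represented by a relation between the
cells of the `n`-th partition. -/
def discrepancy (R : X → X → Prop) {n : ℕ} (r : (Fin n → Bool) → (Fin n → Bool) → Prop) :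
    Set (X × X) :=
  {q | cellMap n q.1 = cellMap n q.2 ∨ ¬ (R q.1 q.2 ↔ r (cellMap n q.1) (cellMap n q.2))}

theorem measurableSet_discrepancy {R : X → X → Prop} (hR : MeasurableSet {q : X × X | R q.1 q.2})
    {n : ℕ} (r : (Fin n → Bool) → (Fin n → Bool) → Prop) : MeasurableSet (discrepancy R r) := by
  have hr : MeasurableSet {q : X × X | r (cellMap n q.1) (cellMap n q.2)} :=
    measurable_cellMap_prod n
      (Set.toFinite {c : (Fin n → Bool) × (Fin n → Bool) | r c.1 c.2}).measurableSet
  have e : discrepancy R r = {q : X × X | cellMap n q.1 = cellMap n q.2} ∪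
      symmDiff {q : X × X | R q.1 q.2} {q : X × X | r (cellMap n q.1) (cellMap n q.2)} := by
    ext q
    simp only [discrepancy, Set.mem_ofPred_eq, Set.mem_union, Set.mem_symmDiff]
    tauto
  rw [e]
  exact (measurableSet_sameCell n).union (hR.symmDiff hr)

end Cells

/-! ### Ordered pairs of distinct points and their moment measure -/

section PairMeasure

variable {X : Type*} [MeasurableSpace X] [MeasurableSingletonClass X]

/-- The counting measure on the ordered pairs of distinct points of a finite set. -/
noncomputable def pairMeasure (s : Finset X) : Measure (X × X) :=
  Measure.count.restrict (s : Set X).offDiag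

theorem pairMeasure_apply (s : Finset X) {S : Set (X × X)} (hS : MeasurableSet S) :
    pairMeasure s S = ((S ∩ (s : Set X).offDiag).encard : ℝ≥0∞) := by
  have hfin : (s : Set X).offDiag.Finite := s.finite_toSet.offDiag
  rw [pairMeasure, Measure.restrict_apply hS,
    Measure.count_apply (hS.inter hfin.measurableSet)]

instance (s : Finset X) : IsFiniteMeasure (pairMeasure s) := by
  refine ⟨?_⟩
  rw [pairMeasure_apply s MeasurableSet.univ]
  have hfin : (Set.univ ∩ (s : Set X).offDiag).Finite := s.finite_toSet.offDiag.inter_of_right _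
  rw [← hfin.cast_ncard_eq]
  exact ENNReal.natCast_lt_top _

theorem pairMeasure_prod_self (s : Finset X) {A : Set X} (hA : MeasurableSet A) :
    pairMeasure s (A ×ˢ A) = (((s : Set X) ∩ A).ncard.descFactorial 2 : ℝ≥0∞) := by
  classical
  rw [pairMeasure_apply s (hA.prod hA)]
  have e1 : A ×ˢ A ∩ (s : Set X).offDiag = ((s.filter (· ∈ A)).offDiag : Set (X × X)) := by
    ext q
    simp only [Set.mem_inter_iff, Set.mem_prod, Set.mem_offDiag, Finset.mem_coe,
      Finset.mem_offDiag, Finset.mem_filter]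
    tauto
  have e2 : (s : Set X) ∩ A = (s.filter (· ∈ A) : Finset X) := by
    ext q; simp
  rw [e1, e2, Set.encard_coe_eq_coe_finsetCard, Set.ncard_coe_finset, Finset.offDiag_card]
  rw [ENat.toENNReal_coe, Nat.cast_inj, Nat.descFactorial_succ, Nat.descFactorial_one, Nat.sub_mul, one_mul]

theorem pairMeasure_prod_of_disjoint (s : Finset X) {A B : Set X} (hA : MeasurableSet A)
    (hB : MeasurableSet B) (hd : Disjoint A B) :
    pairMeasure s (A ×ˢ B) = (((s : Set X) ∩ A).ncard.descFactorial 1 : ℝ≥0∞) *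
      (((s : Set X) ∩ B).ncard.descFactorial 1 : ℝ≥0∞) := by
  rw [pairMeasure_apply s (hA.prod hB)]
  have e1 : A ×ˢ B ∩ (s : Set X).offDiag = ((s : Set X) ∩ A) ×ˢ ((s : Set X) ∩ B) := by
    ext q
    simp only [Set.mem_inter_iff, Set.mem_prod, Set.mem_offDiag]
    constructor
    · tauto
    · rintro ⟨⟨h1, h2⟩, h3, h4⟩
      exact ⟨⟨h2, h4⟩, h1, h3, fun h => Set.disjoint_left.1 hd h2 (h ▸ h4)⟩
  have hfA : ((s : Set X) ∩ A).Finite := s.finite_toSet.inter_of_left _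
  have hfB : ((s : Set X) ∩ B).Finite := s.finite_toSet.inter_of_left _
  rw [e1, Set.encard_prod, ← hfA.cast_ncard_eq, ← hfB.cast_ncard_eq, ENat.toENNReal_mul,
    ENat.toENNReal_coe, ENat.toENNReal_coe, Nat.descFactorial_one, Nat.descFactorial_one]

end PairMeasure

theorem measurable_ncard_descFactorial {Ω X : Type*} [MeasurableSpace Ω] [MeasurableSpace X]
    {η : Ω → Finset X} {μ : Measure X} {P : Measure Ω}
    (h : IsPoissonProcess (fun ω => (η ω : Set X)) μ P)
    {A : Set X} (hA : MeasurableSet A) (k : ℕ) :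
    Measurable fun ω => (((η ω : Set X) ∩ A).ncard.descFactorial k : ℝ≥0∞) :=
  (Measurable.of_discrete (f := fun n : ℕ∞ => (n.toNat.descFactorial k : ℝ≥0∞))).comp
    (h.measurable_count A hA)

section SecondFactorialMoment

variable {Ω X : Type*} [MeasurableSpace Ω] [MeasurableSpace X] [MeasurableSingletonClass X]
  [MeasurableSpace.CountablyGenerated X] {η : Ω → Finset X} {μ : Measure X} {P : Measure Ω}

theorem measurable_pairMeasure_prod (h : IsPoissonProcess (fun ω => (η ω : Set X)) μ P)
    {n : ℕ} (c : (Fin n → Bool) × (Fin n → Bool)) :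
    Measurable fun ω => pairMeasure (η ω) ((cellMap n ⁻¹' {c.1}) ×ˢ (cellMap n ⁻¹' {c.2})) := by
  by_cases hc : c.1 = c.2
  · simp_rw [hc, pairMeasure_prod_self _ (measurableSet_cell n c.2)]
    exact measurable_ncard_descFactorial h (measurableSet_cell n _) 2
  · have hd : Disjoint (cellMap n ⁻¹' {c.1} : Set X) (cellMap n ⁻¹' {c.2}) :=
      Disjoint.preimage _ (by simpa using hc)
    simp_rw [pairMeasure_prod_of_disjoint _ (measurableSet_cell n c.1) (measurableSet_cell n c.2)
      hd]
    exact (measurable_ncard_descFactorial h (measurableSet_cell n _) 1).mul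
      (measurable_ncard_descFactorial h (measurableSet_cell n _) 1)

/-- Two cells of one level are equal or disjoint, so on their products the pair measure is a
polynomial in measurable counts; a π-system argument extends this to all measurable sets. -/
theorem measurable_pairMeasure (h : IsPoissonProcess (fun ω => (η ω : Set X)) μ P) :
    Measurable fun ω => pairMeasure (η ω) := by
  have hb : ∀ S ∈ cellAlgebra X, Measurable fun ω => pairMeasure (η ω) S := by
    rintro _ ⟨n, r, rfl⟩
    simp_rw [measure_cellMap_prod_preimage]
    exact Finset.measurable_fun_sum _ fun c _ => measurable_pairMeasure_prod h c
  refine Measurable.measure_of_isPiSystem generateFrom_cellAlgebra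
    (fun S hS T hT _ => isSetAlgebra_cellAlgebra.inter_mem hS hT) hb ?_
  exact hb _ isSetAlgebra_cellAlgebra.univ_mem

variable [IsFiniteMeasure μ]

/-- For equal cells this is the second factorial moment of a Poisson count; for distinct cells it is
independence. -/
theorem lintegral_pairMeasure_prod (h : IsPoissonProcess (fun ω => (η ω : Set X)) μ P)
    {n : ℕ} (c : (Fin n → Bool) × (Fin n → Bool)) :
    ∫⁻ ω, pairMeasure (η ω) ((cellMap n ⁻¹' {c.1}) ×ˢ (cellMap n ⁻¹' {c.2})) ∂P =
      μ (cellMap n ⁻¹' {c.1}) * μ (cellMap n ⁻¹' {c.2}) := by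
  by_cases hc : c.1 = c.2
  · simp_rw [hc, pairMeasure_prod_self _ (measurableSet_cell n c.2)]
    rw [h.lintegral_descFactorial (measurableSet_cell n _) (measure_ne_top _ _), sq]
  · have hd : Disjoint (cellMap n ⁻¹' {c.1} : Set X) (cellMap n ⁻¹' {c.2}) :=
      Disjoint.preimage _ (by simpa using hc)
    simp_rw [pairMeasure_prod_of_disjoint _ (measurableSet_cell n c.1) (measurableSet_cell n c.2)
      hd]
    have hI := (h.indepFun_encard (measurableSet_cell n c.1) (measurableSet_cell n c.2) hd).comp
      (φ := fun n : ℕ∞ => (n.toNat.descFactorial 1 : ℝ≥0∞))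
      (ψ := fun n : ℕ∞ => (n.toNat.descFactorial 1 : ℝ≥0∞))
      Measurable.of_discrete Measurable.of_discrete
    have := lintegral_mul_eq_lintegral_mul_lintegral_of_indepFun
      (measurable_ncard_descFactorial h (measurableSet_cell n c.1) 1)
      (measurable_ncard_descFactorial h (measurableSet_cell n c.2) 1) hI
    simp only [Pi.mul_apply] at this
    rw [this, h.lintegral_descFactorial (measurableSet_cell n _) (measure_ne_top _ _),
      h.lintegral_descFactorial (measurableSet_cell n _) (measure_ne_top _ _), pow_one, pow_one]

/-- The second factorial moment measure of a Poisson process is the square of its intensity. -/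
theorem lintegral_pairMeasure (h : IsPoissonProcess (fun ω => (η ω : Set X)) μ P)
    {S : Set (X × X)} (hS : MeasurableSet S) :
    ∫⁻ ω, pairMeasure (η ω) S ∂P = μ.prod μ S := by
  have hm := measurable_pairMeasure h
  have key : μ.prod μ = P.bind fun ω => pairMeasure (η ω) := by
    have hb : ∀ S ∈ cellAlgebra X, μ.prod μ S = P.bind (fun ω => pairMeasure (η ω)) S := by
      intro S hS
      have hSm : MeasurableSet S := by
        obtain ⟨n, r, rfl⟩ := hS
        exact measurable_cellMap_prod n r.toFinite.measurableSet
      obtain ⟨n, r, rfl⟩ := hS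
      rw [Measure.bind_apply hSm hm.aemeasurable]
      simp_rw [measure_cellMap_prod_preimage]
      rw [lintegral_finsetSum _ fun c _ => measurable_pairMeasure_prod h c]
      refine Finset.sum_congr rfl fun c _ => ?_
      rw [lintegral_pairMeasure_prod h, Measure.prod_prod]
    exact ext_of_generate_finite (cellAlgebra X) generateFrom_cellAlgebra
      (fun S hS T hT _ => isSetAlgebra_cellAlgebra.inter_mem hS hT) hb
      (hb _ isSetAlgebra_cellAlgebra.univ_mem)
  rw [key, Measure.bind_apply hS hm.aemeasurable]

/-- The first-moment bound that makes every discretisation error small. -/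
theorem measure_exists_pair_le (h : IsPoissonProcess (fun ω => (η ω : Set X)) μ P)
    {S : Set (X × X)} (hS : MeasurableSet S) :
    P {ω | ∃ x ∈ η ω, ∃ y ∈ η ω, x ≠ y ∧ (x, y) ∈ S} ≤ μ.prod μ S := by
  rw [← lintegral_pairMeasure h hS]
  have hmS : Measurable fun ω => pairMeasure (η ω) S :=
    (Measure.measurable_coe hS).comp (measurable_pairMeasure h)
  have h1 := mul_meas_ge_le_lintegral (μ := P) hmS 1
  rw [one_mul] at h1
  refine le_trans (measure_mono ?_) h1
  rintro ω ⟨x, hx, y, hy, hxy, hS'⟩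
  change 1 ≤ pairMeasure (η ω) S
  rw [pairMeasure_apply _ hS]
  have : (1 : ℕ∞) ≤ (S ∩ (η ω : Set X).offDiag).encard :=
    Set.one_le_encard_iff_nonempty.2 ⟨(x, y), hS', hx, hy, hxy⟩
  exact_mod_cast this

end SecondFactorialMoment

/-! ### Approximating a relation on points by a relation on cells -/

section Approximation

variable {X : Type*} [MeasurableSpace X] [MeasurableSpace.CountablyGenerated X]
  [MeasurableSpace.SeparatesPoints X]

theorem iInter_sameCell :
    ⋂ n, {q : X × X | cellMap n q.1 = cellMap n q.2} = Set.diagonal X := by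
  ext q
  simp only [Set.mem_iInter, Set.mem_ofPred_eq, Set.mem_diagonal_iff]
  refine ⟨fun h => MeasurableSpace.injective_mapNatBool X (funext fun k => ?_), fun h n => by rw [h]⟩
  exact congrFun (h (k + 1)) (Fin.last k)

theorem measurableSet_diagonal_of_separatesPoints : MeasurableSet (Set.diagonal X) := by
  rw [← iInter_sameCell]
  exact MeasurableSet.iInter measurableSet_sameCell

/-- The cells separate points, so the same-cell sets decrease to the diagonal, which is a null set
by Fubini because `μ` has no atoms. Continuity from above concludes. -/
theorem exists_sameCell_lt (μ : Measure X) [IsFiniteMeasure μ] [NullSingletonClass μ] {ε : ℝ≥0∞}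
    (hε : 0 < ε) :
    ∃ n₀, ∀ n ≥ n₀, μ.prod μ {q : X × X | cellMap n q.1 = cellMap n q.2} < ε := by
  have h0 : μ.prod μ (Set.diagonal X) = 0 := by
    rw [Measure.prod_apply measurableSet_diagonal_of_separatesPoints]
    have : ∀ x : X, Prod.mk x ⁻¹' Set.diagonal X = {x} := fun x => by
      ext y; simp [eq_comm]
    simp [this]
  have ht := tendsto_measure_iInter_atTop (μ := μ.prod μ)
    (fun n => (measurableSet_sameCell (X := X) n).nullMeasurableSet) antitone_sameCell
    ⟨0, measure_ne_top _ _⟩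
  rw [iInter_sameCell, h0] at ht
  exact Filter.eventually_atTop.1 (ht.eventually_lt_const hε)

/-- The algebra of cell products is dense in the product σ-algebra for the finite measure `μ.prod
μ`. Three errors of `ε / 3` occur: pairs in one cell, the approximation error, and its mirror image.
-/
theorem exists_discrepancy_lt (μ : Measure X) [IsFiniteMeasure μ] [NullSingletonClass μ]
    {R : X → X → Prop} (hR : MeasurableSet {q : X × X | R q.1 q.2})
    (hsymm : ∀ x y, R x y → R y x) {ε : ℝ} (hε : 0 < ε) :
    ∃ (n : ℕ) (r : (Fin n → Bool) → (Fin n → Bool) → Prop), (∀ a b, r a b → r b a) ∧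
      (∀ a, ¬ r a a) ∧ μ.prod μ (discrepancy R r) ≤ ENNReal.ofReal ε := by
  have hε3 : 0 < ε / 3 := by positivity
  obtain ⟨n₀, hn₀⟩ := exists_sameCell_lt μ (ENNReal.ofReal_pos.2 hε3)
  obtain ⟨_, ⟨n₁, s₁, rfl⟩, hs⟩ :=
    (Measure.MeasureDense.of_generateFrom_isSetAlgebra_finite (μ.prod μ)
      isSetAlgebra_cellAlgebra generateFrom_cellAlgebra).approx _ hR (measure_ne_top _ _) _ hε3
  obtain ⟨n, hn⟩ : ∃ n, n = max n₀ n₁ := ⟨_, rfl⟩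
  obtain ⟨s, hs'⟩ := exists_refined_relation (X := X) (hn ▸ le_max_right n₀ n₁ : n₁ ≤ n) s₁
  rw [hs'] at hs
  set S : Set (X × X) := (fun q : X × X => (cellMap n q.1, cellMap n q.2)) ⁻¹' s with hSdef
  set T : Set (X × X) := symmDiff {q : X × X | R q.1 q.2} S with hT
  have hTm : MeasurableSet T :=
    hR.symmDiff (measurable_cellMap_prod n s.toFinite.measurableSet)
  have hswap : μ.prod μ (Prod.swap ⁻¹' T) = μ.prod μ T := by
    rw [← Measure.map_apply measurable_swap hTm, Measure.prod_swap]
  -- Symmetrising and removing the diagonal forces symmetry and irreflexivity. Since `R` is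
  -- symmetric, any new error lies in the swapped error set or in a common cell.
  refine ⟨n, fun a b => (a, b) ∈ s ∧ (b, a) ∈ s ∧ a ≠ b, fun a b h => ⟨h.2.1, h.1, h.2.2.symm⟩,
    fun a h => h.2.2 rfl, ?_⟩
  have hsub : discrepancy R (fun a b => (a, b) ∈ s ∧ (b, a) ∈ s ∧ a ≠ b) ⊆
      {q : X × X | cellMap n q.1 = cellMap n q.2} ∪ (T ∪ Prod.swap ⁻¹' T) := by
    rintro ⟨x, y⟩ hq
    have h1 := hsymm x y
    have h2 := hsymm y x
    simp only [discrepancy, Set.mem_ofPred_eq, Set.mem_union, Set.mem_preimage, hT,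
      Set.mem_symmDiff, Prod.swap, hSdef] at hq ⊢
    tauto
  calc μ.prod μ _ ≤ μ.prod μ ({q : X × X | cellMap n q.1 = cellMap n q.2} ∪
        (T ∪ Prod.swap ⁻¹' T)) := measure_mono hsub
    _ ≤ μ.prod μ {q : X × X | cellMap n q.1 = cellMap n q.2} +
        (μ.prod μ T + μ.prod μ (Prod.swap ⁻¹' T)) :=
      (measure_union_le _ _).trans (add_le_add le_rfl (measure_union_le _ _))
    _ ≤ ENNReal.ofReal (ε / 3) + (ENNReal.ofReal (ε / 3) + ENNReal.ofReal (ε / 3)) := by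
      rw [hswap]
      exact add_le_add (hn₀ n (hn ▸ le_max_left _ _)).le (add_le_add hs.le hs.le)
    _ = ENNReal.ofReal ε := by
      rw [← ENNReal.ofReal_add hε3.le hε3.le, ← ENNReal.ofReal_add hε3.le (by positivity)]
      congr 1; ring

end Approximation

/-! ### Graph isomorphism under injective relabelling -/

section Relabelling

variable {X J : Type*} [DecidableEq J] {R : X → X → Prop} {r : J → J → Prop} {s : Finset X}
  {c : X → J}

theorem degreeIn_image (hc : Set.InjOn c s) {x : X} (h : ∀ y ∈ s, R x y ↔ r (c x) (c y)) :
    degreeIn r (s.image c) (c x) = degreeIn R s x := by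
  classical
  rw [degreeIn, Finset.filter_image,
    Finset.card_image_of_injOn (hc.mono (Finset.coe_subset.2 (Finset.filter_subset _ _))), degreeIn]
  congr 1
  exact Finset.filter_congr fun y hy => (h y hy).symm

theorem pairCount_image (hc : Set.InjOn c s) (h : ∀ x ∈ s, ∀ y ∈ s, R x y ↔ r (c x) (c y)) :
    pairCount r (s.image c) = pairCount R s := by
  rw [pairCount, Finset.sum_image hc, pairCount]
  exact Finset.sum_congr rfl fun x hx => degreeIn_image hc (h x hx)

end Relabelling

/-! ### Transfer of edge and degree bounds to the Poisson process -/

section PoissonGraph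

variable {Ω X : Type*} [MeasurableSpace X] [MeasurableSpace.CountablyGenerated X]
  {η : Ω → Finset X} {R : X → X → Prop}

theorem occupied_cells_eq_image (s : Finset X) (n : ℕ) :
    occupied (fun a => ((s : Set X) ∩ cellMap n ⁻¹' {a}).encard) = s.image (cellMap n) := by
  classical
  ext a
  simp only [occupied, Finset.mem_filter, Finset.mem_univ, true_and, Finset.mem_image, ne_eq,
    Set.encard_eq_zero, ← Set.nonempty_iff_ne_empty]
  constructor
  · rintro ⟨x, hx, hxa⟩
    exact ⟨x, hx, hxa⟩
  · rintro ⟨x, hx, hxa⟩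
    exact ⟨x, hx, hxa⟩

theorem pairwise_disjoint_cells (n : ℕ) :
    Pairwise (Function.onFun Disjoint fun a : Fin n → Bool => (cellMap n ⁻¹' {a} : Set X)) :=
  fun _ _ hab => Disjoint.preimage _ (by simpa using hab)

/-- The event that the relation `R` between points of the process is not represented by the
relation `r` between cells. -/
def discrepancyEvent (η : Ω → Finset X) (R : X → X → Prop) {n : ℕ}
    (r : (Fin n → Bool) → (Fin n → Bool) → Prop) : Set Ω :=
  {ω | ∃ x ∈ η ω, ∃ y ∈ η ω, x ≠ y ∧ (x, y) ∈ discrepancy R r}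

/-- Discrepancy is only tested at distinct points; irreflexivity of both relations supplies the
remaining case `x = y`. -/
theorem injOn_and_iff_of_notMem_discrepancyEvent (hirr : ∀ x, ¬ R x x) {n : ℕ}
    {r : (Fin n → Bool) → (Fin n → Bool) → Prop} (hr : ∀ a, ¬ r a a) {ω : Ω}
    (hω : ω ∉ discrepancyEvent η R r) :
    Set.InjOn (cellMap n) (η ω : Set X) ∧
      ∀ x ∈ η ω, ∀ y ∈ η ω, R x y ↔ r (cellMap n x) (cellMap n y) := by
  have h : ∀ x ∈ η ω, ∀ y ∈ η ω, x ≠ y → cellMap n x ≠ cellMap n y ∧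
      (R x y ↔ r (cellMap n x) (cellMap n y)) := by
    intro x hx y hy hxy
    have : (x, y) ∉ discrepancy R r := fun hd => hω ⟨x, hx, y, hy, hxy, hd⟩
    simpa only [discrepancy, Set.mem_ofPred_eq, not_or, not_not] using this
  refine ⟨fun x hx y hy hxy => ?_, fun x hx y hy => ?_⟩
  · by_contra hne
    exact (h x hx y hy hne).1 hxy
  · by_cases hxy : x = y
    · subst hxy
      exact iff_of_false (hirr x) (hr _)
    · exact (h x hx y hy hxy).2

variable [MeasurableSpace.SeparatesPoints X] [MeasurableSingletonClass X]
  [MeasurableSpace Ω] {μ : Measure X} {P : Measure Ω} [IsFiniteMeasure μ] [NullSingletonClass μ]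

/-- Concentration of the number of related pairs of points of a Poisson process, on the event
that all degrees are bounded. -/
theorem measureReal_pairCount_mul_le [IsProbabilityMeasure P]
    (h : IsPoissonProcess (fun ω => (η ω : Set X)) μ P)
    (hR : MeasurableSet {q : X × X | R q.1 q.2}) (hsymm : ∀ x y, R x y → R y x)
    (hirr : ∀ x, ¬ R x x) {a b D : ℝ} (ha : 0 ≤ a) (hab : a < b) (hD : 0 < D) :
    P.real {ω | (pairCount R (η ω) : ℝ) ≤ 2 * a} *
      P.real {ω | 2 * b ≤ pairCount R (η ω) ∧ ∀ x ∈ η ω, (degreeIn R (η ω) x : ℝ) ≤ D} ≤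
        Real.exp (-((b - a) ^ 2 / (12 * D * b))) := by
  refine le_of_forall_pos_le_add fun ε hε => ?_
  obtain ⟨n, r, hrs, hri, hr⟩ := exists_discrepancy_lt μ hR hsymm (half_pos hε)
  have hG : P.real (discrepancyEvent η R r) ≤ ε / 2 := by
    have := (measure_exists_pair_le h (measurableSet_discrepancy hR r)).trans hr
    exact ENNReal.toReal_le_of_le_ofReal (by positivity) this
  set N : (Fin n → Bool) → Ω → ℕ∞ := fun a ω => ((η ω : Set X) ∩ cellMap n ⁻¹' {a}).encard with hN
  have hNm : ∀ a, Measurable (N a) := fun a => h.measurable_count _ (measurableSet_cell n a)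
  have hI : iIndepFun N P :=
    h.iIndepFun_encard _ (measurableSet_cell n) (pairwise_disjoint_cells n)
  set p : (Fin n → Bool) → ℝ := fun a => P.real {ω | N a ω ≠ 0} with hp
  -- A cell of finite intensity is empty with positive probability.
  have hp1 : ∀ a, p a < 1 := by
    intro a
    have hz : MeasurableSet {ω | N a ω = 0} := hNm a (MeasurableSet.singleton _)
    have e : {ω | N a ω ≠ 0} = {ω | N a ω = 0}ᶜ := rfl
    simp only [hp]
    rw [e, probReal_compl_eq_one_sub hz, measureReal_def,
      h.measure_encard_eq_zero (measurableSet_cell n a) (measure_ne_top _ _),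
      ENNReal.toReal_ofReal (Real.exp_pos _).le]
    linarith [Real.exp_pos (-(μ (cellMap n ⁻¹' {a})).toReal)]
  have hT := bernoulliProb_pairCount_mul_le (r := r) (p := p) (fun a => measureReal_nonneg) hp1
    Finset.univ hrs ha hab hD
  rw [← measureReal_occupied_eq hNm hI, ← measureReal_occupied_eq hNm hI] at hT
  simp only [hN, occupied_cells_eq_image] at hT
  set A : Set Ω := {ω | (pairCount R (η ω) : ℝ) ≤ 2 * a}
  set B : Set Ω := {ω | 2 * b ≤ pairCount R (η ω) ∧ ∀ x ∈ η ω, (degreeIn R (η ω) x : ℝ) ≤ D}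
  set A' : Set Ω := {ω | (η ω).image (cellMap n) ∈ {S | (pairCount r S : ℝ) ≤ 2 * a}}
  set B' : Set Ω := {ω | (η ω).image (cellMap n) ∈
    {S | 2 * b ≤ pairCount r S ∧ ∀ j ∈ S, (degreeIn r S j : ℝ) ≤ D}}
  have hA : A ⊆ discrepancyEvent η R r ∪ A' := by
    intro ω hω
    by_cases hd : ω ∈ discrepancyEvent η R r
    · exact Or.inl hd
    · obtain ⟨hinj, hiff⟩ := injOn_and_iff_of_notMem_discrepancyEvent hirr hri hd
      refine Or.inr ?_
      change (pairCount r ((η ω).image (cellMap n)) : ℝ) ≤ 2 * a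
      rw [pairCount_image hinj hiff]
      exact hω
  have hB : B ⊆ discrepancyEvent η R r ∪ B' := by
    intro ω hω
    by_cases hd : ω ∈ discrepancyEvent η R r
    · exact Or.inl hd
    · obtain ⟨hinj, hiff⟩ := injOn_and_iff_of_notMem_discrepancyEvent hirr hri hd
      refine Or.inr ⟨?_, ?_⟩
      · rw [pairCount_image hinj hiff]
        exact hω.1
      · intro j hj
        obtain ⟨x, hx, rfl⟩ := Finset.mem_image.1 hj
        rw [degreeIn_image hinj (hiff x hx)]
        exact hω.2 x hx
  have hA' : P.real A ≤ ε / 2 + P.real A' :=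
    ((measureReal_mono hA).trans (measureReal_union_le _ _)).trans (by gcongr)
  have hB' : P.real B ≤ ε / 2 + P.real B' :=
    ((measureReal_mono hB).trans (measureReal_union_le _ _)).trans (by gcongr)
  have hA1 : P.real A ≤ 1 := measureReal_le_one
  have hB1 : P.real B' ≤ 1 := measureReal_le_one
  have hA0 : 0 ≤ P.real A := measureReal_nonneg
  have hB0 : 0 ≤ P.real B' := measureReal_nonneg
  calc P.real A * P.real B ≤ P.real A * (ε / 2 + P.real B') := by gcongr
    _ ≤ ε / 2 + P.real A * P.real B' := by nlinarith
    _ ≤ ε / 2 + (ε / 2 + P.real A') * P.real B' := by gcongr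
    _ ≤ ε / 2 + (ε / 2 + P.real A' * P.real B') := by nlinarith
    _ ≤ _ := by linarith

/-- A union bound for the existence of a point of large degree in a Poisson process. -/
theorem measure_exists_le_degreeIn_le (h : IsPoissonProcess (fun ω => (η ω : Set X)) μ P)
    (hR : MeasurableSet {q : X × X | R q.1 q.2}) (hsymm : ∀ x y, R x y → R y x)
    (hirr : ∀ x, ¬ R x x) (k : ℕ) {H : ℝ≥0∞}
    (hH : ∀ x, P {ω | (k : ℕ∞) ≤ ((η ω : Set X) ∩ {y | R x y}).encard} ≤ H) :
    P {ω | ∃ x ∈ η ω, k ≤ degreeIn R (η ω) x} ≤ H * μ Set.univ := by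
  classical
  refine ENNReal.le_of_forall_pos_le_add fun ε hε _ => ?_
  have hε' : (0 : ℝ) < ε / 2 := by positivity
  obtain ⟨n, r, -, hri, hr⟩ := exists_discrepancy_lt μ hR hsymm hε'
  have hG : P (discrepancyEvent η R r) ≤ ENNReal.ofReal (ε / 2) :=
    (measure_exists_pair_le h (measurableSet_discrepancy hR r)).trans hr
  set C : (Fin n → Bool) → Set X := fun a => cellMap n ⁻¹' {a} with hC
  set U : (Fin n → Bool) → Set X := fun a => {y | r a (cellMap n y)} with hU
  have hUm : ∀ a, MeasurableSet (U a) := fun a =>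
    measurable_cellMap n (Set.toFinite {b | r a b}).measurableSet
  set g : (Fin n → Bool) → ℝ≥0∞ := fun a => P {ω | (k : ℕ∞) ≤ ((η ω : Set X) ∩ U a).encard} with hg
  have hsub : {ω | ∃ x ∈ η ω, k ≤ degreeIn R (η ω) x} ⊆ discrepancyEvent η R r ∪
      ⋃ a, {ω | ((η ω : Set X) ∩ C a).encard ≠ 0} ∩
        {ω | (k : ℕ∞) ≤ ((η ω : Set X) ∩ U a).encard} := by
    rintro ω ⟨x, hx, hk⟩
    by_cases hd : ω ∈ discrepancyEvent η R r
    · exact Or.inl hd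
    · obtain ⟨-, hiff⟩ := injOn_and_iff_of_notMem_discrepancyEvent hirr hri hd
      refine Or.inr (Set.mem_iUnion.2 ⟨cellMap n x, ?_, ?_⟩)
      · exact Set.encard_ne_zero.2 ⟨x, hx, rfl⟩
      · change (k : ℕ∞) ≤ _
        calc (k : ℕ∞) ≤ (degreeIn R (η ω) x : ℕ∞) := by exact_mod_cast hk
          _ = (((η ω).filter (R x) : Finset X) : Set X).encard := by
            rw [Set.encard_coe_eq_coe_finsetCard, degreeIn]
          _ ≤ _ := Set.encard_le_encard fun y hy => by
            have hy' := Finset.mem_filter.1 (Finset.mem_coe.1 hy)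
            exact ⟨hy'.1, (hiff x hx y hy'.1).1 hy'.2⟩
  -- Irreflexivity of `r` makes a cell disjoint from the union of its related cells, so occupancy of
  -- the one is independent of the count in the other.
  have hprod : ∀ a, P ({ω | ((η ω : Set X) ∩ C a).encard ≠ 0} ∩
      {ω | (k : ℕ∞) ≤ ((η ω : Set X) ∩ U a).encard}) ≤ μ (C a) * g a := by
    intro a
    have hd : Disjoint (C a) (U a) := by
      refine Set.disjoint_left.2 fun y hy hy' => hri a ?_
      have : cellMap n y = a := hy
      simpa only [hU, Set.mem_ofPred_eq, this] using hy'
    have hI := (h.indepFun_encard (measurableSet_cell n a) (hUm a) hd).measure_inter_preimage_eq_mul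
      {0}ᶜ {m : ℕ∞ | (k : ℕ∞) ≤ m} MeasurableSet.of_discrete MeasurableSet.of_discrete
    refine hI.le.trans ?_
    exact mul_le_mul_left
      (h.measure_encard_ne_zero_le (measurableSet_cell n a) (measure_ne_top _ _)) _
  have hsum : ∑ a, μ (C a) * g a = ∫⁻ x, g (cellMap n x) ∂μ := by
    rw [← lintegral_map (f := g) Measurable.of_discrete (measurable_cellMap n), lintegral_fintype]
    refine Finset.sum_congr rfl fun a _ => ?_
    rw [Measure.map_apply (measurable_cellMap n) (MeasurableSet.singleton a), mul_comm]
  -- The related cells are replaced by the true neighbourhood of `x`, at the price of a point in the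
  -- discrepancy section at `x`; Fubini later integrates these sections to the small total
  -- discrepancy.
  have hpt : ∀ x, g (cellMap n x) ≤ H + μ (Prod.mk x ⁻¹' discrepancy R r) := by
    intro x
    have hDm : MeasurableSet (Prod.mk x ⁻¹' discrepancy R r) :=
      measurable_prodMk_left (measurableSet_discrepancy hR r)
    have hs : {ω | (k : ℕ∞) ≤ ((η ω : Set X) ∩ U (cellMap n x)).encard} ⊆
        {ω | (k : ℕ∞) ≤ ((η ω : Set X) ∩ {y | R x y}).encard} ∪
          {ω | ((η ω : Set X) ∩ Prod.mk x ⁻¹' discrepancy R r).encard ≠ 0} := by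
      intro ω hω
      by_cases hz : ((η ω : Set X) ∩ Prod.mk x ⁻¹' discrepancy R r).encard = 0
      · refine Or.inl (le_trans hω (Set.encard_le_encard ?_))
        rintro y ⟨hy, hyU⟩
        refine ⟨hy, ?_⟩
        have hnd : y ∉ Prod.mk x ⁻¹' discrepancy R r := fun hyd => by
          have := Set.encard_eq_zero.1 hz
          exact (this ▸ (⟨hy, hyd⟩ : y ∈ (η ω : Set X) ∩ Prod.mk x ⁻¹' discrepancy R r) :
            y ∈ (∅ : Set X))
        simp only [discrepancy, Set.mem_preimage, Set.mem_ofPred_eq, not_or, not_not] at hnd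
        exact hnd.2.2 hyU
      · exact Or.inr hz
    calc g (cellMap n x) ≤ _ := measure_mono hs
      _ ≤ _ := measure_union_le _ _
      _ ≤ _ := add_le_add (hH x) (h.measure_encard_ne_zero_le hDm (measure_ne_top _ _))
  calc P {ω | ∃ x ∈ η ω, k ≤ degreeIn R (η ω) x}
      ≤ P (discrepancyEvent η R r) + P (⋃ a, {ω | ((η ω : Set X) ∩ C a).encard ≠ 0} ∩
        {ω | (k : ℕ∞) ≤ ((η ω : Set X) ∩ U a).encard}) :=
        (measure_mono hsub).trans (measure_union_le _ _)
    _ ≤ ENNReal.ofReal (ε / 2) + ∑ a, μ (C a) * g a :=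
        add_le_add hG ((measure_iUnion_fintype_le _ _).trans (Finset.sum_le_sum fun a _ => hprod a))
    _ ≤ ENNReal.ofReal (ε / 2) + ∫⁻ x, (H + μ (Prod.mk x ⁻¹' discrepancy R r)) ∂μ := by
        rw [hsum]
        exact add_le_add le_rfl (lintegral_mono hpt)
    _ = ENNReal.ofReal (ε / 2) + (H * μ Set.univ + μ.prod μ (discrepancy R r)) := by
        rw [lintegral_add_left measurable_const, lintegral_const,
          ← Measure.prod_apply (measurableSet_discrepancy hR r)]
    _ ≤ ENNReal.ofReal (ε / 2) + (H * μ Set.univ + ENNReal.ofReal (ε / 2)) := by gcongr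
    _ = H * μ Set.univ + ε := by
        rw [add_left_comm, ← ENNReal.ofReal_add hε'.le hε'.le, add_halves,
          ENNReal.ofReal_coe_nnreal]

end PoissonGraph

/-- The Chernoff bound for the Poisson tail, in the range needed for degrees. -/
theorem pow_div_factorial_le_exp {r : ℝ} (hr : 0 ≤ r) {k : ℕ} (hk0 : 0 < k)
    (hk : 2 * r / 3 ≤ k) :
    (r / Real.exp 2) ^ k / k.factorial ≤ Real.exp (-(1 / 16) * r) ^ 5 := by
  have hkr : (0 : ℝ) < k := by exact_mod_cast hk0
  have h1 : (k : ℝ) ^ k / k.factorial ≤ Real.exp k := Real.pow_div_factorial_le_exp _ hkr.le k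
  have hhalf : (3 / 2 : ℝ) ≤ Real.exp (1 / 2) := by
    have := Real.add_one_le_exp (1 / 2 : ℝ)
    linarith
  have hrk : r ≤ 3 / 2 * k := by linarith
  have h2 : r / Real.exp 2 ≤ k * Real.exp (-(3 / 2)) := by
    rw [div_le_iff₀ (Real.exp_pos _), mul_assoc, ← Real.exp_add]
    have : (-(3 / 2) + 2 : ℝ) = 1 / 2 := by norm_num
    rw [this]
    nlinarith
  calc (r / Real.exp 2) ^ k / k.factorial
      ≤ (k * Real.exp (-(3 / 2))) ^ k / k.factorial := by gcongr
    _ = (k : ℝ) ^ k / k.factorial * Real.exp (-(3 / 2)) ^ k := by rw [mul_pow]; ring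
    _ ≤ Real.exp k * Real.exp (-(3 / 2)) ^ k := by gcongr
    _ = Real.exp (-(k / 2)) := by
      rw [← Real.exp_nat_mul, ← Real.exp_add]; congr 1; ring
    -- Here `k / 2 ≥ r / 3`, and `1 / 3 > 5 / 16`.
    _ ≤ Real.exp (-(1 / 16) * r) ^ 5 := by
      rw [← Real.exp_nat_mul]
      apply Real.exp_le_exp.2
      push_cast
      linarith

theorem pairCount_le_card_sq {X : Type*} (R : X → X → Prop) (s : Finset X) :
    pairCount R s ≤ s.card ^ 2 := by
  classical
  rw [pairCount, sq, ← smul_eq_mul]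
  exact Finset.sum_le_card_nsmul _ _ _ fun x _ => Finset.card_filter_le _ _

/-! ### Concentration of the edge count around its median -/

section MedianConcentration

variable {Ω X : Type*} [MeasurableSpace Ω] [MeasurableSpace X]
  {η : Ω → Finset X} {μ : Measure X} {P : Measure Ω}
  {R : X → X → Prop} [IsFiniteMeasure μ] [IsProbabilityMeasure P]

/-- Concentration around the median when the process is empty with probability above one half. -/
theorem measureReal_median_le_of_small (h : IsPoissonProcess (fun ω => (η ω : Set X)) μ P)
    {m u : ℝ} (hu : 0 < u) (hm0 : 0 ≤ m)
    (hm : 1 / 2 ≤ P.real {ω | m ≤ (pairCount R (η ω) : ℝ) / 2})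
    (hsmall : μ.real Set.univ < 0.69) :
    P.real {ω | u ≤ |(pairCount R (η ω) : ℝ) / 2 - m|} ≤
      4 * μ.real Set.univ * Real.exp (-(1 / 16) * (u / √(u + m))) := by
  set Λ := μ.real Set.univ with hΛ
  have hΛ0 : 0 ≤ Λ := measureReal_nonneg
  -- Since `0.69 < log 2`, the process is empty with probability above one half, which excludes a
  -- positive median.
  have hm00 : m = 0 := by
    by_contra hne
    have hmpos : 0 < m := lt_of_le_of_ne hm0 (Ne.symm hne)
    have hz := h.measure_encard_eq_zero MeasurableSet.univ (measure_ne_top _ _)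
    have hzm : MeasurableSet {ω | ((η ω : Set X) ∩ Set.univ).encard = 0} :=
      h.measurable_count _ MeasurableSet.univ (MeasurableSet.singleton 0)
    have hsub : {ω | m ≤ (pairCount R (η ω) : ℝ) / 2} ⊆
        {ω | ((η ω : Set X) ∩ Set.univ).encard = 0}ᶜ := by
      intro ω hω hω0
      have he : η ω = ∅ := by
        have : ((η ω : Set X) ∩ Set.univ).encard = 0 := hω0
        simpa using this
      have hω' : m ≤ (pairCount R (η ω) : ℝ) / 2 := hω
      rw [he] at hω'
      simp only [pairCount, Finset.sum_empty, Nat.cast_zero, zero_div] at hω'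
      linarith
    have h1 := hm.trans (measureReal_mono (μ := P) hsub)
    rw [probReal_compl_eq_one_sub hzm, measureReal_def, hz,
      ENNReal.toReal_ofReal (Real.exp_pos _).le] at h1
    have h2 : Real.exp (-Real.log 2) < Real.exp (-Λ) :=
      Real.exp_lt_exp.2 (by linarith [Real.log_two_gt_d9])
    rw [Real.exp_neg, Real.exp_log (by norm_num)] at h2
    have h3 : Λ = (μ Set.univ).toReal := rfl
    rw [← h3] at h1
    linarith
  subst hm00
  have hr : u / √(u + 0) = √u := by rw [add_zero, Real.div_sqrt]
  rw [hr]
  -- At least `u` edges need at least `√u` points. Of the bound `Λ ^ k`, one factor `Λ` is kept and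
  -- the others give the exponential; rounding is absorbed by the constant 4.
  set k := ⌈√u⌉₊ with hk
  have hsu : 0 < √u := Real.sqrt_pos.2 hu
  have hk1 : 1 ≤ k := Nat.one_le_ceil_iff.2 hsu
  have hku : √u ≤ k := Nat.le_ceil _
  have hsub : {ω | u ≤ |(pairCount R (η ω) : ℝ) / 2 - 0|} ⊆
      {ω | (k : ℕ∞) ≤ ((η ω : Set X) ∩ Set.univ).encard} := by
    intro ω hω
    have hω' : u ≤ |(pairCount R (η ω) : ℝ) / 2 - 0| := hω
    rw [sub_zero, abs_of_nonneg (by positivity)] at hω'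
    have hp : (pairCount R (η ω) : ℝ) ≤ ((η ω).card : ℝ) ^ 2 := by
      exact_mod_cast pairCount_le_card_sq R (η ω)
    have hc : √u ≤ (η ω).card := Real.sqrt_le_iff.2 ⟨Nat.cast_nonneg _, by linarith⟩
    have : k ≤ (η ω).card := Nat.ceil_le.2 hc
    change (k : ℕ∞) ≤ ((η ω : Set X) ∩ Set.univ).encard
    rw [Set.inter_univ, Set.encard_coe_eq_coe_finsetCard]
    exact_mod_cast this
  have h1 : P.real {ω | u ≤ |(pairCount R (η ω) : ℝ) / 2 - 0|} ≤ Λ ^ k / k.factorial := by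
    have h2 := (measure_mono hsub).trans
      (h.measure_le_encard MeasurableSet.univ (measure_ne_top _ _) k)
    have h3 := ENNReal.toReal_mono (ENNReal.div_ne_top
      (ENNReal.pow_ne_top (measure_ne_top _ _)) (by simp [Nat.factorial_ne_zero])) h2
    rw [ENNReal.toReal_div, ENNReal.toReal_pow, ENNReal.toReal_natCast] at h3
    exact h3
  have h2 : Λ ^ k / k.factorial ≤ Λ ^ k :=
    div_le_self (by positivity) (by exact_mod_cast Nat.one_le_iff_ne_zero.2 k.factorial_ne_zero)
  obtain ⟨j, hj⟩ : ∃ j, k = j + 1 := ⟨k - 1, by omega⟩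
  have hle : Λ ≤ Real.exp (-(1 / 16)) := by
    have := Real.add_one_le_exp (-(1 / 16) : ℝ)
    linarith
  have h3 : Λ ^ j ≤ Real.exp (-(1 / 16) * j) := by
    calc Λ ^ j ≤ Real.exp (-(1 / 16)) ^ j := by gcongr
      _ = _ := by rw [← Real.exp_nat_mul, mul_comm]
  have h4 : Real.exp (-(1 / 16) * j) ≤ 4 * Real.exp (-(1 / 16) * √u) := by
    have h5 : (j : ℝ) + 1 = k := by rw [hj]; push_cast; ring
    have h6 : Real.exp (-(1 / 16) * j) ≤ Real.exp 1 * Real.exp (-(1 / 16) * √u) := by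
      rw [← Real.exp_add]
      apply Real.exp_le_exp.2
      linarith
    have h7 : Real.exp 1 ≤ 4 := by linarith [Real.exp_one_lt_d9]
    exact h6.trans (mul_le_mul_of_nonneg_right h7 (Real.exp_pos _).le)
  calc _ ≤ Λ ^ k := h1.trans h2
    _ = Λ * Λ ^ j := by rw [hj, pow_succ, mul_comm]
    _ ≤ Λ * (4 * Real.exp (-(1 / 16) * √u)) := by gcongr; exact h3.trans h4
    _ = _ := by ring

variable [MeasurableSpace.CountablyGenerated X] [MeasurableSpace.SeparatesPoints X]
  [MeasurableSingletonClass X] [NullSingletonClass μ]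

/-- Concentration around the median for the number of related pairs of points of a Poisson
process, when the relation is local. -/
theorem measureReal_median_le (h : IsPoissonProcess (fun ω => (η ω : Set X)) μ P)
    (hR : MeasurableSet {q : X × X | R q.1 q.2}) (hsymm : ∀ x y, R x y → R y x)
    (hirr : ∀ x, ¬ R x x) {m u : ℝ} (hu : 0 < u)
    (hm1 : 1 / 2 ≤ P.real {ω | (pairCount R (η ω) : ℝ) / 2 ≤ m})
    (hm2 : 1 / 2 ≤ P.real {ω | m ≤ (pairCount R (η ω) : ℝ) / 2})
    (hball : ∀ x, μ {y | R x y} ≤ ENNReal.ofReal (u / √(u + m) / Real.exp 2)) :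
    P.real {ω | u ≤ |(pairCount R (η ω) : ℝ) / 2 - m|} ≤
      4 * μ.real Set.univ * Real.exp (-(1 / 16) * (u / √(u + m))) := by
  have hm0 : 0 ≤ m := by
    by_contra hneg
    push Not at hneg
    have : {ω | (pairCount R (η ω) : ℝ) / 2 ≤ m} = ∅ := by
      refine Set.eq_empty_of_forall_notMem fun ω hω => ?_
      have hω' : (pairCount R (η ω) : ℝ) / 2 ≤ m := hω
      have : (0 : ℝ) ≤ (pairCount R (η ω) : ℝ) / 2 := by positivity
      linarith
    rw [this] at hm1
    norm_num at hm1
  rcases lt_or_ge (μ.real Set.univ) 0.69 with hsmall | hlarge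
  · exact measureReal_median_le_of_small h hu hm0 hm2 hsmall
  set r := u / √(u + m) with hr
  set Λ := μ.real Set.univ with hΛ
  set E := Real.exp (-(1 / 16) * r) with hE
  rcases le_or_gt 1 (4 * Λ * E) with htriv | hnt
  · exact measureReal_le_one.trans htriv
  have hum : 0 < u + m := by linarith
  have hs : 0 < √(u + m) := Real.sqrt_pos.2 hum
  have hr0 : 0 < r := div_pos hu hs
  have hr2 : r ^ 2 = u ^ 2 / (u + m) := by rw [hr, div_pow, Real.sq_sqrt hum.le]
  have hE0 : 0 < E := Real.exp_pos _
  -- From `4 * Λ * E < 1` and `Λ ≥ 0.69`.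
  have hE1 : E ≤ 0.3624 := by nlinarith
  -- This makes `12 * D * b = 8 * r * b`, so for `b ≤ u + m` the concentration bound is at most `exp
  -- (-r / 8) = E ^ 2`. Degrees are integers, hence exceeding `D` means reaching `⌊D⌋₊ + 1`.
  set D := 2 * r / 3 with hD
  have hD0 : 0 < D := by positivity
  set k := ⌊D⌋₊ + 1 with hk
  have hkD : D ≤ k := by rw [hk]; push_cast; exact (Nat.lt_floor_add_one D).le
  -- the exceptional event of a large degree
  set Q : Set Ω := {ω | ∃ x ∈ η ω, k ≤ degreeIn R (η ω) x} with hQ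
  have hp : P.real Q ≤ Λ * E ^ 5 := by
    have h1 := measure_exists_le_degreeIn_le h hR hsymm hirr k (H := ENNReal.ofReal (E ^ 5))
      (fun x => by
        refine (h.measure_le_encard (measurable_prodMk_left hR) (measure_ne_top _ _) k).trans ?_
        calc μ {y | R x y} ^ k / k.factorial
            ≤ ENNReal.ofReal (r / Real.exp 2) ^ k / k.factorial := by
              gcongr
              exact hball x
          _ = ENNReal.ofReal ((r / Real.exp 2) ^ k / k.factorial) := by
              rw [← ENNReal.ofReal_pow (by positivity), ENNReal.ofReal_div_of_pos (by positivity),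
                ENNReal.ofReal_natCast]
          _ ≤ _ := ENNReal.ofReal_le_ofReal
              (pow_div_factorial_le_exp hr0.le (Nat.succ_pos _) hkD))
    have h2 := ENNReal.toReal_mono (ENNReal.mul_ne_top ENNReal.ofReal_ne_top
      (measure_ne_top _ _)) h1
    rw [ENNReal.toReal_mul, ENNReal.toReal_ofReal (by positivity)] at h2
    rw [mul_comm]
    exact h2
  have hdeg : ∀ ω, ω ∉ Q → ∀ x ∈ η ω, (degreeIn R (η ω) x : ℝ) ≤ D := by
    intro ω hω x hx
    by_contra hlt
    push Not at hlt
    exact hω ⟨x, hx, Nat.succ_le_of_lt ((Nat.floor_lt hD0.le).2 hlt)⟩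
  have hsplit : ∀ b : ℝ, P.real {ω | b ≤ (pairCount R (η ω) : ℝ) / 2} ≤
      P.real {ω | 2 * b ≤ pairCount R (η ω) ∧ ∀ x ∈ η ω, (degreeIn R (η ω) x : ℝ) ≤ D} +
        P.real Q := by
    intro b
    refine (measureReal_mono ?_).trans (measureReal_union_le _ _)
    intro ω hω
    by_cases hωQ : ω ∈ Q
    · exact Or.inr hωQ
    · have hω' : b ≤ (pairCount R (η ω) : ℝ) / 2 := hω
      exact Or.inl ⟨by linarith, hdeg ω hωQ⟩
  have hmed : ∀ a : ℝ, {ω | (pairCount R (η ω) : ℝ) / 2 ≤ a} =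
      {ω | (pairCount R (η ω) : ℝ) ≤ 2 * a} := by
    intro a
    ext ω
    change (pairCount R (η ω) : ℝ) / 2 ≤ a ↔ (pairCount R (η ω) : ℝ) ≤ 2 * a
    constructor <;> intro h <;> linarith
  have hE2 : ∀ b, 0 < b → b ≤ u + m → Real.exp (-(u ^ 2 / (12 * D * b))) ≤ E ^ 2 := by
    intro b hb hbm
    rw [hE, ← Real.exp_nat_mul]
    apply Real.exp_le_exp.2
    have h1 : r ^ 2 ≤ u ^ 2 / b := by rw [hr2]; gcongr
    have h2 : u ^ 2 / (12 * D * b) = u ^ 2 / b / (8 * r) := by rw [hD]; field_simp; ring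
    have h3 : r / 8 ≤ u ^ 2 / (12 * D * b) := by
      rw [h2, le_div_iff₀ (by positivity)]
      linarith
    push_cast
    linarith
  have hpsmall : Λ * E ^ 5 ≤ 0.01 := by
    have h1 : Λ * E ≤ 1 / 4 := by linarith
    have h2 : E ^ 4 ≤ 0.3624 ^ 4 := by gcongr
    calc Λ * E ^ 5 = (Λ * E) * E ^ 4 := by ring
      _ ≤ 1 / 4 * 0.3624 ^ 4 := by gcongr
      _ ≤ 0.01 := by norm_num
  have hupper : P.real {ω | m + u ≤ (pairCount R (η ω) : ℝ) / 2} ≤ 2 * E ^ 2 + Λ * E ^ 5 := by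
    have h1 := measureReal_pairCount_mul_le h hR hsymm hirr hm0 (lt_add_of_pos_right m hu) hD0
    rw [← hmed, add_sub_cancel_left] at h1
    have h2 := h1.trans (hE2 (m + u) (by linarith) (by linarith))
    have h3 := hsplit (m + u)
    have h4 : 0 ≤ P.real {ω | 2 * (m + u) ≤ pairCount R (η ω) ∧
      ∀ x ∈ η ω, (degreeIn R (η ω) x : ℝ) ≤ D} := measureReal_nonneg
    nlinarith
  have hlower : P.real {ω | (pairCount R (η ω) : ℝ) / 2 ≤ m - u} ≤ 2.3 * E ^ 2 := by
    rcases lt_or_ge m u with hmu | hmu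
    · have : {ω | (pairCount R (η ω) : ℝ) / 2 ≤ m - u} = ∅ := by
        refine Set.eq_empty_of_forall_notMem fun ω hω => ?_
        have hω' : (pairCount R (η ω) : ℝ) / 2 ≤ m - u := hω
        have : (0 : ℝ) ≤ (pairCount R (η ω) : ℝ) / 2 := by positivity
        linarith
      rw [this, measureReal_empty]
      positivity
    · have h1 := measureReal_pairCount_mul_le h hR hsymm hirr (sub_nonneg.2 hmu)
        (sub_lt_self m hu) hD0
      rw [← hmed, sub_sub_cancel] at h1
      have h2 := h1.trans (hE2 m (by linarith) (by linarith))
      -- At least `m` edges and small degrees occur together with probability at least `1 / 2 -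
      -- 0.01`, and `1 / 0.49 < 2.3`.
      have h3 := hsplit m
      have h4 : 0 ≤ P.real {ω | (pairCount R (η ω) : ℝ) / 2 ≤ m - u} := measureReal_nonneg
      nlinarith
  have htotal : P.real {ω | u ≤ |(pairCount R (η ω) : ℝ) / 2 - m|} ≤
      (2 * E ^ 2 + Λ * E ^ 5) + 2.3 * E ^ 2 := by
    refine le_trans ?_ (add_le_add hupper hlower)
    refine (measureReal_mono ?_).trans (measureReal_union_le _ _)
    intro ω hω
    have hω' : u ≤ |(pairCount R (η ω) : ℝ) / 2 - m| := hω
    rcases le_abs.1 hω' with h1 | h1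
    · exact Or.inl (show m + u ≤ (pairCount R (η ω) : ℝ) / 2 by linarith)
    · exact Or.inr (show (pairCount R (η ω) : ℝ) / 2 ≤ m - u by linarith)
  -- It remains to compare `4.3 * E` with `3.98 * Λ`; the bounds `E ≤ 0.3624` and `Λ ≥ 0.69`
  -- suffice.
  refine htotal.trans ?_
  have hE4 : E ^ 4 ≤ 0.02 := (pow_le_pow_left₀ hE0.le hE1 4).trans (by norm_num)
  have h5 : Λ * E ^ 5 ≤ 0.02 * (Λ * E) := by
    calc Λ * E ^ 5 = E ^ 4 * (Λ * E) := by ring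
      _ ≤ 0.02 * (Λ * E) := by gcongr
  nlinarith

end MedianConcentration

/-! ### Topology of flats and measurability of the close-pair relation -/

namespace Flat

variable {d i : ℕ}

theorem continuous_directionProj : Continuous (directionProj : Flat d i → _) :=
  continuous_fst.comp (continuous_induced_dom (f := fun h : Flat d i => (h.directionProj, h.foot)))

theorem continuous_foot : Continuous (foot : Flat d i → _) :=
  continuous_snd.comp (continuous_induced_dom (f := fun h : Flat d i => (h.directionProj, h.foot)))

theorem foot_mem (h : Flat d i) : h.foot ∈ h.toAffineSubspace := by
  have : Nonempty h.toAffineSubspace := h.nonempty'.to_subtype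
  exact (EuclideanGeometry.orthogonalProjection h.toAffineSubspace 0).2

/-- Incidence becomes an equation between continuous functions of the point and the flat's
coordinates, hence a closed condition. -/
theorem mem_points_iff (h : Flat d i) (x : EuclideanSpace ℝ (Fin d)) :
    x ∈ h.points ↔ h.directionProj (x - h.foot) = x - h.foot := by
  rw [directionProj, Submodule.starProjection_eq_self_iff, ← vsub_eq_sub,
    AffineSubspace.vsub_right_mem_direction_iff_mem h.foot_mem]
  rfl

/-- The parametrisation of a flat by its orthogonal projection. -/
noncomputable def point (h : Flat d i) (v : EuclideanSpace ℝ (Fin d)) :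
    EuclideanSpace ℝ (Fin d) := h.directionProj v + h.foot

theorem point_mem (h : Flat d i) (v : EuclideanSpace ℝ (Fin d)) : h.point v ∈ h.points := by
  rw [mem_points_iff, point, add_sub_cancel_right, directionProj,
    Submodule.starProjection_eq_self_iff]
  exact Submodule.starProjection_apply_mem _ _

theorem exists_point_eq (h : Flat d i) {x : EuclideanSpace ℝ (Fin d)} (hx : x ∈ h.points) :
    ∃ v, h.point v = x :=
  ⟨x - h.foot, by rw [point, (h.mem_points_iff x).1 hx, sub_add_cancel]⟩

theorem continuous_point (v : EuclideanSpace ℝ (Fin d)) :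
    Continuous fun h : Flat d i => h.point v :=
  (continuous_directionProj.clm_apply continuous_const).add continuous_foot

theorem injective_directionProj_foot :
    Function.Injective fun h : Flat d i => (h.directionProj, h.foot) := by
  intro h g hg
  obtain ⟨h1, h2⟩ := Prod.ext_iff.1 hg
  simp only at h1 h2
  have : h.toAffineSubspace = g.toAffineSubspace := by
    ext x
    have a := h.mem_points_iff x
    have b := g.mem_points_iff x
    rw [h1, h2] at a
    exact a.trans b.symm
  cases h; cases g
  simpa using this

theorem isEmbedding_directionProj_foot :
    Topology.IsEmbedding fun h : Flat d i => (h.directionProj, h.foot) :=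
  ⟨⟨rfl⟩, injective_directionProj_foot⟩

instance : T2Space (Flat d i) := isEmbedding_directionProj_foot.t2Space

instance : SecondCountableTopology (Flat d i) := by
  have : ProperSpace (EuclideanSpace ℝ (Fin d) →L[ℝ] EuclideanSpace ℝ (Fin d)) :=
    FiniteDimensional.proper ℝ _
  exact isEmbedding_directionProj_foot.toIsInducing.secondCountableTopology

theorem isClosed_setOf_mem_points {T : Type*} [TopologicalSpace T] {h : T → Flat d i}
    {x : T → EuclideanSpace ℝ (Fin d)} (hh : Continuous h) (hx : Continuous x) :
    IsClosed {a | x a ∈ (h a).points} := by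
  simp only [mem_points_iff]
  have hc : Continuous fun a => x a - (h a).foot := hx.sub (continuous_foot.comp hh)
  exact isClosed_eq ((continuous_directionProj.comp hh).clm_apply hc) hc

/-- The set is closed: it is the projection of the closed incidence set along the compact factor
`W`. -/
theorem measurableSet_hitting {W : Set (EuclideanSpace ℝ (Fin d))} (hW : IsCompact W) :
    MeasurableSet (hitting W : Set (Flat d i)) := by
  have : CompactSpace W := isCompact_iff_compactSpace.1 hW
  have e : (hitting W : Set (Flat d i)) =
      Prod.fst '' {a : Flat d i × W | (a.2 : EuclideanSpace ℝ (Fin d)) ∈ a.1.points} := by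
    ext h
    constructor
    · rintro ⟨x, hx, hxW⟩
      exact ⟨(h, ⟨x, hxW⟩), hx, rfl⟩
    · rintro ⟨⟨g, x⟩, hx, rfl⟩
      exact ⟨x, hx, x.2⟩
  rw [e]
  exact (isClosedMap_fst_of_compactSpace _ (isClosed_setOf_mem_points continuous_fst
    (continuous_subtype_val.comp continuous_snd))).measurableSet

theorem flatDist_le_dist {h g : Flat d i} {x y : EuclideanSpace ℝ (Fin d)} (hx : x ∈ h.points)
    (hy : y ∈ g.points) : flatDist h g ≤ dist x y :=
  ciInf_le (f := fun p : h.points × g.points => dist (p.1 : EuclideanSpace ℝ (Fin d)) p.2)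
    ⟨0, by rintro _ ⟨p, rfl⟩; exact dist_nonneg⟩ (⟨x, hx⟩, ⟨y, hy⟩)

theorem flatDist_lt_iff {h g : Flat d i} {c : ℝ} :
    flatDist h g < c ↔ ∃ v w, dist (h.point v) (g.point w) < c := by
  have : Nonempty (h.points × g.points) := ⟨(⟨_, h.point_mem 0⟩, ⟨_, g.point_mem 0⟩)⟩
  constructor
  · intro hlt
    obtain ⟨⟨⟨x, hx⟩, ⟨y, hy⟩⟩, hxy⟩ := exists_lt_of_ciInf_lt hlt
    obtain ⟨v, rfl⟩ := h.exists_point_eq hx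
    obtain ⟨w, rfl⟩ := g.exists_point_eq hy
    exact ⟨v, w, hxy⟩
  · rintro ⟨v, w, hvw⟩
    exact (flatDist_le_dist (h.point_mem v) (g.point_mem w)).trans_lt hvw

theorem flatDist_comm (h g : Flat d i) : flatDist h g = flatDist g h := by
  refine eq_of_forall_gt_iff fun c => ?_
  rw [flatDist_lt_iff, flatDist_lt_iff]
  constructor <;> rintro ⟨v, w, hvw⟩ <;> exact ⟨w, v, by rwa [dist_comm]⟩

/-- The distance is an infimum of continuous functions, hence upper semicontinuous. Continuity may
fail where flats become parallel. -/
theorem isOpen_setOf_flatDist_lt {T : Type*} [TopologicalSpace T] {h g : T → Flat d i} {f : T → ℝ}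
    (hh : Continuous h) (hg : Continuous g) (hf : Continuous f) :
    IsOpen {a | flatDist (h a) (g a) < f a} := by
  have e : {a | flatDist (h a) (g a) < f a} =
      ⋃ v, ⋃ w, {a | dist ((h a).point v) ((g a).point w) < f a} := by
    ext a
    simp [flatDist_lt_iff]
  rw [e]
  exact isOpen_iUnion fun v => isOpen_iUnion fun w =>
    isOpen_lt (((continuous_point v).comp hh).dist ((continuous_point w).comp hg)) hf

theorem measurable_flatDist : Measurable fun q : Flat d i × Flat d i => flatDist q.1 q.2 :=
  measurable_of_Iio fun _ =>
    (isOpen_setOf_flatDist_lt continuous_fst continuous_snd continuous_const).measurableSet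

theorem IsMidpoint.symm {h g : Flat d i} {p : EuclideanSpace ℝ (Fin d)} (hp : IsMidpoint h g p) :
    IsMidpoint g h p := by
  obtain ⟨x, hx, y, hy, hxy, rfl⟩ := hp
  exact ⟨y, hy, x, hx, by rw [dist_comm, hxy, flatDist_comm], midpoint_comm _ _⟩

/-- With `w` half the segment, the equality of lengths reduces to one inequality, the other being
automatic. The remaining one is a closed condition because `flatDist` is upper semicontinuous. -/
theorem isMidpoint_iff {h g : Flat d i} {p : EuclideanSpace ℝ (Fin d)} :
    IsMidpoint h g p ↔ ∃ w, p + w ∈ h.points ∧ p - w ∈ g.points ∧ 2 * ‖w‖ ≤ flatDist h g := by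
  have hd : ∀ w : EuclideanSpace ℝ (Fin d), dist (p + w) (p - w) = 2 * ‖w‖ := fun w => by
    rw [dist_eq_norm, add_sub_sub_cancel, ← two_smul ℝ w, norm_smul]
    norm_num
  constructor
  · rintro ⟨x, hx, y, hy, hxy, hp⟩
    have hsum : x + y = p + p := by rw [hp, midpoint_add_self]
    have e1 : p + (x - p) = x := by abel
    have e2 : p - (x - p) = y := by
      rw [← sub_eq_zero]
      calc p - (x - p) - y = (p + p) - (x + y) := by abel
        _ = 0 := by rw [hsum, sub_self]
    refine ⟨x - p, by rwa [e1], by rwa [e2], ?_⟩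
    rw [← hd, e1, e2, hxy]
  · rintro ⟨w, h1, h2, hw⟩
    refine ⟨p + w, h1, p - w, h2, le_antisymm (by rwa [hd]) (flatDist_le_dist h1 h2), ?_⟩
    rw [midpoint_eq_smul_add]
    have : p + w + (p - w) = (2 : ℝ) • p := by rw [two_smul]; abel
    rw [this, smul_smul]
    norm_num

/-- Distance at most `δ` confines the half-segment to a ball of radius `δ / 2`, so midpoint and
half-segment range over a compact set and the closed witness set has a closed projection. -/
theorem measurableSet_close_midpoint {W : Set (EuclideanSpace ℝ (Fin d))} (hW : IsCompact W)
    (δ : ℝ) : MeasurableSet {q : Flat d i × Flat d i |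
      flatDist q.1 q.2 ≤ δ ∧ ∃ p ∈ W, IsMidpoint q.1 q.2 p} := by
  set K : Set (EuclideanSpace ℝ (Fin d) × EuclideanSpace ℝ (Fin d)) :=
    W ×ˢ Metric.closedBall 0 (δ / 2) with hK
  have : CompactSpace K :=
    isCompact_iff_compactSpace.1 (hW.prod (isCompact_closedBall 0 (δ / 2)))
  set C : Set ((Flat d i × Flat d i) × K) :=
    {a | a.2.1.1 + a.2.1.2 ∈ a.1.1.points} ∩ {a | a.2.1.1 - a.2.1.2 ∈ a.1.2.points} ∩
      {a | flatDist a.1.1 a.1.2 < 2 * ‖a.2.1.2‖}ᶜ with hC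
  have hc1 : Continuous fun a : (Flat d i × Flat d i) × K => a.2.1.1 := by fun_prop
  have hc2 : Continuous fun a : (Flat d i × Flat d i) × K => a.2.1.2 := by fun_prop
  have hCc : IsClosed C :=
    ((isClosed_setOf_mem_points (continuous_fst.comp continuous_fst) (hc1.add hc2)).inter
      (isClosed_setOf_mem_points (continuous_snd.comp continuous_fst) (hc1.sub hc2))).inter
      (isOpen_setOf_flatDist_lt (continuous_fst.comp continuous_fst)
        (continuous_snd.comp continuous_fst) (continuous_const.mul hc2.norm)).isClosed_compl
  have e : {q : Flat d i × Flat d i | flatDist q.1 q.2 ≤ δ ∧ ∃ p ∈ W, IsMidpoint q.1 q.2 p} =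
      {q | flatDist q.1 q.2 ≤ δ} ∩ Prod.fst '' C := by
    ext q
    simp only [Set.mem_ofPred_eq, Set.mem_inter_iff, isMidpoint_iff]
    refine and_congr_right fun hδ => ?_
    constructor
    · rintro ⟨p, hp, w, h1, h2, hw⟩
      have hwK : (p, w) ∈ K := ⟨hp, by rw [mem_closedBall_zero_iff]; linarith⟩
      exact ⟨(q, ⟨(p, w), hwK⟩), ⟨⟨h1, h2⟩, not_lt.2 hw⟩, rfl⟩
    · rintro ⟨⟨q', ⟨⟨p, w⟩, hpw⟩⟩, ⟨⟨h1, h2⟩, hw⟩, rfl⟩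
      exact ⟨p, hpw.1, w, h1, h2, not_lt.1 hw⟩
  rw [e]
  exact (measurableSet_le measurable_flatDist measurable_const).inter
    (isClosedMap_fst_of_compactSpace _ hCc).measurableSet

/-- The relation whose pairs are counted by `midpointCount`. -/
def closePair (W : Set (EuclideanSpace ℝ (Fin d))) (δ : ℝ) (h g : Flat d i) : Prop :=
  h ∈ hitting W ∧ g ∈ hitting W ∧ h ≠ g ∧ flatDist h g ≤ δ ∧ ∃ p ∈ W, IsMidpoint h g p

theorem closePair.symm {W : Set (EuclideanSpace ℝ (Fin d))} {δ : ℝ} {h g : Flat d i}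
    (hc : closePair W δ h g) : closePair W δ g h := by
  obtain ⟨h1, h2, h3, h4, p, hp, hm⟩ := hc
  exact ⟨h2, h1, h3.symm, by rwa [flatDist_comm], p, hp, hm.symm⟩

theorem measurableSet_closePair {W : Set (EuclideanSpace ℝ (Fin d))} (hW : IsCompact W) (δ : ℝ) :
    MeasurableSet {q : Flat d i × Flat d i | closePair W δ q.1 q.2} := by
  have e : {q : Flat d i × Flat d i | closePair W δ q.1 q.2} =
      (hitting W ×ˢ hitting W) ∩ ((Set.diagonal (Flat d i))ᶜ ∩
        {q | flatDist q.1 q.2 ≤ δ ∧ ∃ p ∈ W, IsMidpoint q.1 q.2 p}) := by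
    ext q
    simp only [closePair, Set.mem_ofPred_eq, Set.mem_inter_iff, Set.mem_prod, Set.mem_compl_iff,
      Set.mem_diagonal_iff]
    tauto
  rw [e]
  exact ((measurableSet_hitting hW).prod (measurableSet_hitting hW)).inter
    (isClosed_diagonal.measurableSet.compl.inter (measurableSet_close_midpoint hW δ))

end Flat

theorem encard_setOf_related_pairs {X : Type*} (R : X → X → Prop) (s : Finset X) :
    {q : X × X | q.1 ∈ s ∧ q.2 ∈ s ∧ R q.1 q.2}.encard = (pairCount R s : ℕ∞) := by
  classical
  have e : {q : X × X | q.1 ∈ s ∧ q.2 ∈ s ∧ R q.1 q.2} =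
      ((s ×ˢ s).filter fun q : X × X => R q.1 q.2 : Finset (X × X)) := by
    ext q
    simp [and_assoc]
  rw [e, Set.encard_coe_eq_coe_finsetCard, Finset.card_filter, Finset.sum_product, pairCount]
  simp only [degreeIn, Finset.card_filter]

namespace Flat

variable {d i : ℕ}

theorem midpointCount_eq_ofReal_pairCount {W : Set (EuclideanSpace ℝ (Fin d))} {δ : ℝ}
    {η : Set (Flat d i)} {s : Finset (Flat d i)} (hs : (s : Set (Flat d i)) = η ∩ hitting W) :
    midpointCount W δ η = ENNReal.ofReal ((pairCount (closePair W δ) s : ℝ) / 2) := by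
  have e : {q : Flat d i × Flat d i | q.1 ∈ η ∩ hitting W ∧ q.2 ∈ η ∩ hitting W ∧ q.1 ≠ q.2 ∧
      flatDist q.1 q.2 ≤ δ ∧ ∃ p ∈ W, IsMidpoint q.1 q.2 p} =
      {q | q.1 ∈ s ∧ q.2 ∈ s ∧ closePair W δ q.1 q.2} := by
    ext q
    have h1 : q.1 ∈ s ↔ q.1 ∈ η ∩ hitting W := by rw [← hs, Finset.mem_coe]
    have h2 : q.2 ∈ s ↔ q.2 ∈ η ∩ hitting W := by rw [← hs, Finset.mem_coe]
    simp only [Set.mem_ofPred_eq, h1, h2, closePair, Set.mem_inter_iff]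
    tauto
  rw [midpointCount, e, encard_setOf_related_pairs, ENat.toENNReal_coe,
    ENNReal.ofReal_div_of_pos (by norm_num), ENNReal.ofReal_natCast, one_div,
    ENNReal.div_eq_inv_mul, ENNReal.ofReal_ofNat]

/-- The supremum only controls flats that meet `W`; any other flat has no close pairs, so the
neighbourhood bound holds for every `h`. -/
theorem restrict_closePair_le (θ : Measure (Flat d i)) (W : Set (EuclideanSpace ℝ (Fin d)))
    {t δ r : ℝ}
    (hcond : ENNReal.ofReal (Real.exp 2 * t) *
        (⨆ h ∈ (hitting W : Set (Flat d i)), θ (ball W h δ)) ≤ ENNReal.ofReal r)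
    (h : Flat d i) :
    ((ENNReal.ofReal t • θ).restrict (hitting W)) {g | closePair W δ h g} ≤
      ENNReal.ofReal (r / Real.exp 2) := by
  by_cases hh : h ∈ (hitting W : Set (Flat d i))
  · have hsub : {g | closePair W δ h g} ⊆ ball W h δ := fun g hg => ⟨hg.2.1, hg.2.2.2.1⟩
    have hsup : θ (ball W h δ) ≤ ⨆ h ∈ (hitting W : Set (Flat d i)), θ (ball W h δ) :=
      le_iSup₂ (f := fun h (_ : h ∈ (hitting W : Set (Flat d i))) => θ (ball W h δ)) h hh
    calc ((ENNReal.ofReal t • θ).restrict (hitting W)) {g | closePair W δ h g}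
        ≤ (ENNReal.ofReal t • θ) (ball W h δ) :=
          (Measure.restrict_apply_le _ _).trans (measure_mono hsub)
      _ = ENNReal.ofReal t * θ (ball W h δ) := rfl
      _ ≤ ENNReal.ofReal (r / Real.exp 2) := by
        rw [ENNReal.ofReal_div_of_pos (Real.exp_pos 2),
          ENNReal.le_div_iff_mul_le (Or.inl (by simp [Real.exp_pos])) (Or.inl (by simp))]
        refine le_trans ?_ hcond
        rw [ENNReal.ofReal_mul (Real.exp_pos 2).le]
        calc ENNReal.ofReal t * θ (ball W h δ) * ENNReal.ofReal (Real.exp 2)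
            = ENNReal.ofReal (Real.exp 2) * ENNReal.ofReal t * θ (ball W h δ) := by ring
          _ ≤ _ := by gcongr
  · have : {g | closePair W δ h g} = ∅ :=
      Set.eq_empty_of_forall_notMem fun g hg => hh hg.1
    rw [this, measure_empty]
    exact zero_le

end Flat

/-! ### The concentration inequality for flats -/

theorem mainTheorem5 {d i : ℕ} (hi : 2 * i < d)
    (θ : Measure (Flat d i)) [SigmaFinite θ] [NullSingletonClass θ]
    (W : Set (EuclideanSpace ℝ (Fin d))) (hWcompact : IsCompact W) (hWconvex : Convex ℝ W)
    (t : ℝ) (ht : 0 < t) (δ : ℝ)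
    {Ω : Type*} [MeasurableSpace Ω] (P : Measure Ω) [IsProbabilityMeasure P]
    (η : Ω → Set (Flat d i)) (hη : IsPoissonProcess η (ENNReal.ofReal t • θ) P)
    (m : ℝ) (hm : IsMedian P (fun ω => Flat.midpointCount W δ (η ω)) m)
    (u : ℝ) (hu : 0 < u)
    (hcond : ENNReal.ofReal (Real.exp 2 * t) *
        (⨆ h ∈ (Flat.hitting W : Set (Flat d i)), θ (Flat.ball W h δ)) ≤
      ENNReal.ofReal (u / √(u + m))) :
    P {ω | ENNReal.ofReal u ≤
        ((Flat.midpointCount W δ (η ω) : EReal) - (m : EReal)).abs} ≤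
      4 * ENNReal.ofReal t * θ (Flat.hitting W) *
        ENNReal.ofReal (Real.exp (-(1 / 16) * (u / √(u + m)))) := by

  have hV := Flat.measurableSet_hitting (i := i) hWcompact
  -- Infinite intensity makes the right-hand side infinite.
  by_cases htop : θ (Flat.hitting W) = ∞
  · rw [htop, ENNReal.mul_top (mul_ne_zero (by norm_num) (by simpa using ht)),
      ENNReal.top_mul (by simp [Real.exp_pos])]
    exact le_top
  have hVfin : (ENNReal.ofReal t • θ) (Flat.hitting W) ≠ ∞ :=
    ENNReal.mul_ne_top ENNReal.ofReal_ne_top htop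
  obtain ⟨ζ, hζ, hζη⟩ := hη.exists_finset_restrict hV hVfin
  set μ := (ENNReal.ofReal t • θ).restrict (Flat.hitting W) with hμ
  have : IsFiniteMeasure μ := ⟨by rw [hμ, Measure.restrict_apply_univ]; exact hVfin.lt_top⟩
  have : NullSingletonClass μ := ⟨fun x => by
    refine le_antisymm ((Measure.restrict_apply_le _ _).trans ?_) zero_le
    simp⟩
  set N : Ω → ℝ := fun ω => (pairCount (Flat.closePair W δ) (ζ ω) : ℝ) / 2 with hN
  -- Almost surely the extended count is the finite edge count of `ζ`, so the median and deviation
  -- events can be compared with their real-valued versions.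
  have hY : ∀ᵐ ω ∂P, ((Flat.midpointCount W δ (η ω) : ℝ≥0∞) : EReal) = (N ω : EReal) := by
    filter_upwards [hζη] with ω hω
    rw [Flat.midpointCount_eq_ofReal_pairCount hω, EReal.coe_ennreal_ofReal,
      max_eq_left (by positivity)]
  have hhalf : ∀ A B : Set Ω, A ≤ᵐ[P] B → 1 / 2 ≤ P A → 1 / 2 ≤ P.real B := by
    intro A B hAB hA
    have := ENNReal.toReal_mono (measure_ne_top _ _) (hA.trans (measure_mono_ae hAB))
    simpa [measureReal_def] using this
  have hm1 : 1 / 2 ≤ P.real {ω | N ω ≤ m} := by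
    refine hhalf _ _ ?_ hm.1
    filter_upwards [hY] with ω hω hle
    change N ω ≤ m
    have hle' : ((Flat.midpointCount W δ (η ω) : ℝ≥0∞) : EReal) ≤ (m : EReal) := hle
    rw [hω] at hle'
    exact EReal.coe_le_coe_iff.1 hle'
  have hm2 : 1 / 2 ≤ P.real {ω | m ≤ N ω} := by
    refine hhalf _ _ ?_ hm.2
    filter_upwards [hY] with ω hω hle
    change m ≤ N ω
    have hle' : (m : EReal) ≤ ((Flat.midpointCount W δ (η ω) : ℝ≥0∞) : EReal) := hle
    rw [hω] at hle'
    exact EReal.coe_le_coe_iff.1 hle'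
  have hsub : ({ω | ENNReal.ofReal u ≤
      ((Flat.midpointCount W δ (η ω) : EReal) - (m : EReal)).abs} : Set Ω) ≤ᵐ[P]
      {ω | u ≤ |N ω - m|} := by
    filter_upwards [hY] with ω hω hle
    change u ≤ |N ω - m|
    have hle' : ENNReal.ofReal u ≤
      ((Flat.midpointCount W δ (η ω) : EReal) - (m : EReal)).abs := hle
    rw [hω, ← EReal.coe_sub, EReal.abs_def] at hle'
    exact (ENNReal.ofReal_le_ofReal_iff (abs_nonneg _)).1 hle'
  have key := measureReal_median_le hζ (Flat.measurableSet_closePair hWcompact δ)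
    (fun _ _ h => h.symm) (fun _ h => h.2.2.1 rfl) hu hm1 hm2
    (Flat.restrict_closePair_le θ W hcond)
  have hμV : μ.real Set.univ = (ENNReal.ofReal t * θ (Flat.hitting W)).toReal := by
    rw [measureReal_def, hμ, Measure.restrict_apply_univ]
    rfl
  calc P {ω | ENNReal.ofReal u ≤ ((Flat.midpointCount W δ (η ω) : EReal) - (m : EReal)).abs}
      ≤ P {ω | u ≤ |N ω - m|} := measure_mono_ae hsub
    _ = ENNReal.ofReal (P.real {ω | u ≤ |N ω - m|}) := (ofReal_measureReal (measure_ne_top _ _)).symm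
    _ ≤ ENNReal.ofReal (4 * μ.real Set.univ * Real.exp (-(1 / 16) * (u / √(u + m)))) :=
        ENNReal.ofReal_le_ofReal key
    _ = 4 * ENNReal.ofReal t * θ (Flat.hitting W) *
        ENNReal.ofReal (Real.exp (-(1 / 16) * (u / √(u + m)))) := by
        rw [ENNReal.ofReal_mul (by positivity), ENNReal.ofReal_mul (by norm_num), hμV,
          ENNReal.ofReal_toReal (ENNReal.mul_ne_top ENNReal.ofReal_ne_top htop), mul_assoc 4]
        norm_num
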